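/- Conventions. A graph $G$ is a loopless undirected graph with vertices labeled $1,\dots,n$, $n\ge 1$, and a fixed total order on its edges. A broken circuit of $G$ is a cycle of $G$ with its largest edge removed; a non-broken circuit is a spanning subgraph $F$ of $G$ containing no broken circuit (hence a forest). A composition $\alpha=(\alpha_1,\dots,\alpha_l)\models n$ is a finite sequence of positive integers with sum $n$, and $\mathrm{len}(\alpha)=l$. A forest triple of $G$ is a set $\mathcal F=\{(T_j,\alpha^{(j)},r_j)\}_{j=1}^m$ where $T_1,\dots,T_m$ are the trees (connected components) of some non-broken circuit of $G$, $\alpha^{(j)}\models |V(T_j)|$ and $1\le r_j\le\alpha^{(j)}_1$. Its type, $\mathrm{type}(\mathcal F)$, is the partition formed by all parts of all the $\alpha^{(j)}$; its sign is $(-1)^{\sum_j(\mathrm{len}(\alpha^{(j)})-1)}$; it is unit if every $\mathrm{len}(\alpha^{(j)})=1$. Let $(T_{\min},\alpha^{(\min)},r_{\min})$ be the member of $\mathcal F$ whose tree contains vertex $1$, and let $\mathrm{type}'(\mathcal F)$ be $\mathrm{type}(\mathcal F)$ with one part equal to $\alpha^{(\min)}_1$ removed. Write $e_\lambda=\prod_i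 e_{\lambda_i}$ for the elementary symmetric functions in infinitely many variables; $\mathrm{sort}$ turns a tuple into a partition, discarding zero entries ($e_0=1$). A homogeneous symmetric function is $e$-positive if its coefficients in the basis $(e_\lambda)$ are non-negative. A first-preserving involution on a set $S$ of forest triples is an involution $\varphi:S\to S$ that preserves type, $\alpha^{(\min)}_1$ and $r_{\min}$, changes the sign of every forest triple that it does not fix, and all of whose fixed points are unit (so have sign $1$). Let $a\ge 2$ and let $C_a$ be the cycle on $\{1,\dots,a\}$ with edges $(1,2)<\cdots<(a-1,a)<(a,1)$ (for $a=2$, the single edge $(1,2)$). Let $U_k$ be any tree with vertices labeled $1,\dots,k$, $k\ge 1$, and any total order on its edges. Let $C_a+U_k$ be the graph on $\{1,\dots,a+k-1\}$ obtained by shifting the labels of $U_k$ by $a-1$ (so that its vertex $1$ is identified with the vertex $a$ of $C_a$), all edges of $C_a$ preceding those of $U_k$. Let $\mathrm{FT}'(C_a+U_k)$ be the set of forest triples of $C_a+U_k$ whose member $(T,\alpha,r)$ with $a\in V(T)$ satisfies $E(U_k)\subseteq E(T)$ and has last part $\alpha_l\ge k$, and let $\mathrm{FT}'^{(i)}(C_a+U_k)$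 be the subset where $\alpha^{(\min)}_1=i$ and $r_{\min}=1$. Put $$B_{a,k}=\sum_{\mathcal F\in \mathrm{FT}'(C_a+U_k)}\mathrm{sign}(\mathcal F)\,e_{\mathrm{type}(\mathcal F)},\qquad B^{(i)}_{a,k}=\sum_{\mathcal F\in \mathrm{FT}'^{(i)}(C_a+U_k)}\mathrm{sign}(\mathcal F)\,e_{\mathrm{type}'(\mathcal F)}.$$ Lemma. The set $\mathrm{FT}'(C_a+U_k)$ has a first-preserving involution. Moreover $$B_{a,k}=\sum_{\substack{\alpha\models a+k,\ \mathrm{len}(\alpha)\ge 2\\ \alpha_1\le k,\ \alpha_2\ge k}}(\alpha_2-\alpha_1+1)(\alpha_1+\alpha_2-k-1)(\alpha_3-1)\cdots(\alpha_l-1)\,e_{\mathrm{sort}(\alpha_1-1,\alpha_2,\dots,\alpha_l)},$$ and for every integer $i\ge 1$ $$B^{(i)}_{a,k}=\begin{cases}\displaystyle\sum_{\alpha\models a+k-i-1,\ \alpha_1\ge k}(k-i)(\alpha_2-1)\cdots(\alpha_l-1)\,e_{\mathrm{sort}(\alpha)},& i\le k-1,\\[2ex] \displaystyle\sum_{\alpha\models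 a+k-i,\ \alpha_1\le k}(i-k)(\alpha_2-1)\cdots(\alpha_l-1)\,e_{\mathrm{sort}(\alpha_1-1,\alpha_2,\dots,\alpha_l)},& i\ge k,\end{cases}$$ where the sums run over non-empty compositions (an empty sum is $0$). Furthermore $$B_{a,k}=\sum_{i=1}^{a+k-1}e_i\cdot i\cdot B^{(i)}_{a,k},$$ and $B_{a,k}$ and all $B^{(i)}_{a,k}$ with $i\ge1$ are $e$-positive. In particular they depend only on $a$ and $k$, not on the tree $U_k$. -/

import Mathlib

open Finset

/-- A loopless undirected graph with vertex set `{1, …, size}` and a total order on its edges.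
The edges are given as a list without repetitions, written in increasing order. -/
structure LabeledGraph where
  size : ℕ
  size_pos : 1 ≤ size
  edges : List (Sym2 ℕ)
  edges_nodup : edges.Nodup
  edges_loopless : ∀ e ∈ edges, ¬ e.IsDiag
  edges_mem : ∀ e ∈ edges, ∀ v ∈ e, 1 ≤ v ∧ v ≤ size

namespace LabeledGraph

/-- The underlying simple graph (labels outside `{1, …, size}` are isolated and never used). -/
def toSimpleGraph (G : LabeledGraph) : SimpleGraph ℕ :=
  SimpleGraph.fromEdgeSet {e | e ∈ G.edges}

/-- `G`, on its vertex set `{1, …, size}`, is a tree. -/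
def IsTree (G : LabeledGraph) : Prop :=
  (G.toSimpleGraph.induce (Set.Icc 1 G.size)).IsTree

/-- The cycle `C_a` with edges `(1,2) < ⋯ < (a-1,a) < (a,1)`.
For `a = 2` the edges `(1,2)` and `(2,1)` coincide and are listed once. -/
def cycle (a : ℕ) (ha : 2 ≤ a) : LabeledGraph where
  size := a
  size_pos := by omega
  edges := (List.range' 1 (a - 1)).map (fun i => s(i, i + 1)) ++ (if a = 2 then [] else [s(a, 1)])
  edges_nodup := by
    rw [List.nodup_append]
    refine ⟨?_, by split <;> simp, ?_⟩
    · refine List.Nodup.map_on ?_ List.nodup_range'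
      intro x _ y _ h
      simp only [Sym2.eq_iff] at h
      omega
    · intro e he f hf h
      subst h
      split at hf
      · simp at hf
      · simp only [List.mem_map, List.mem_range'_1, List.mem_singleton] at he hf
        obtain ⟨i, hi, rfl⟩ := he
        simp only [Sym2.eq_iff] at hf
        omega
  edges_loopless := by
    intro e he
    rw [List.mem_append] at he
    rcases he with he | he
    · simp only [List.mem_map] at he
      obtain ⟨i, _, rfl⟩ := he
      simp
    · split at he
      · simp at he
      · simp only [List.mem_singleton] at he
        subst he
        simp only [Sym2.mk_isDiag_iff]
        omega
  edges_mem := by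
    intro e he v hv
    rw [List.mem_append] at he
    rcases he with he | he
    · simp only [List.mem_map, List.mem_range'_1] at he
      obtain ⟨i, _, rfl⟩ := he
      simp only [Sym2.mem_iff] at hv
      omega
    · split at he
      · simp at he
      · simp only [List.mem_singleton] at he
        subst he
        simp only [Sym2.mem_iff] at hv
        omega

/-- Relabelling an edge by adding `c` to both endpoints. -/
def shiftEdge (c : ℕ) (e : Sym2 ℕ) : Sym2 ℕ := e.map (· + c)

/-- The sum `G₁ + G₂`: the last vertex of `G₁` is identified with vertex `1` of `G₂`, the labels
of `G₂` are shifted by `|G₁| - 1`, and all edges of `G₁` come before all edges of `G₂`. -/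
def add (G₁ G₂ : LabeledGraph) : LabeledGraph where
  size := G₁.size + G₂.size - 1
  size_pos := by
    have := G₁.size_pos
    have := G₂.size_pos
    omega
  edges := G₁.edges ++ G₂.edges.map (shiftEdge (G₁.size - 1))
  edges_nodup := by
    rw [List.nodup_append]
    refine ⟨G₁.edges_nodup, G₂.edges_nodup.map
      (Sym2.map.injective (add_left_injective _)), ?_⟩
    intro e he f hf h
    subst h
    simp only [List.mem_map] at hf
    obtain ⟨g, hg, rfl⟩ := hf
    induction g using Sym2.ind with
    | _ x y =>
      have h1 := G₁.edges_mem _ he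
      have h2 := G₂.edges_mem _ hg
      have h3 := G₂.edges_loopless _ hg
      simp only [shiftEdge, Sym2.map_mk, Sym2.mem_iff, forall_eq_or_imp, forall_eq,
        Sym2.mk_isDiag_iff] at h1 h2 h3
      omega
  edges_loopless := by
    intro e he
    rw [List.mem_append] at he
    rcases he with he | he
    · exact G₁.edges_loopless e he
    · simp only [List.mem_map] at he
      obtain ⟨g, hg, rfl⟩ := he
      have h3 := G₂.edges_loopless _ hg
      induction g using Sym2.ind with
      | _ x y =>
        simp only [shiftEdge, Sym2.map_mk, Sym2.mk_isDiag_iff] at h3 ⊢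
        omega
  edges_mem := by
    intro e he v hv
    have := G₁.size_pos
    have := G₂.size_pos
    rw [List.mem_append] at he
    rcases he with he | he
    · have := G₁.edges_mem e he v hv
      omega
    · simp only [List.mem_map] at he
      obtain ⟨g, hg, rfl⟩ := he
      simp only [shiftEdge, Sym2.mem_map] at hv
      obtain ⟨w, hw, rfl⟩ := hv
      have := G₂.edges_mem g hg w hw
      omega

/-- `B` is the edge set of a broken circuit: a cycle of `G` without its largest edge. -/
def IsBrokenCircuit (G : LabeledGraph) (B : Finset (Sym2 ℕ)) : Prop :=
  ∃ (v : ℕ) (c : G.toSimpleGraph.Walk v v), c.IsCycle ∧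
    ∃ e ∈ c.edges, (∀ f ∈ c.edges, G.edges.idxOf f ≤ G.edges.idxOf e) ∧
      B = c.edges.toFinset.erase e

/-- `F` is the edge set of a (spanning) non-broken circuit of `G`. -/
def IsNonBroken (G : LabeledGraph) (F : Finset (Sym2 ℕ)) : Prop :=
  F ⊆ G.edges.toFinset ∧ ∀ B, G.IsBrokenCircuit B → ¬ B ⊆ F

/-- The subgraph with vertex set `V` and edge set `E` is one of the connected components
(trees, when `F` is non-broken) of the spanning subgraph of `G` with edge set `F`. -/
def IsComponent (G : LabeledGraph) (F : Finset (Sym2 ℕ)) (V : Finset ℕ) (E : Finset (Sym2 ℕ)) :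
    Prop :=
  (∃ v ∈ Icc 1 G.size, ∀ w, w ∈ V ↔
    w ∈ Icc 1 G.size ∧ (SimpleGraph.fromEdgeSet (F : Set (Sym2 ℕ))).Reachable v w) ∧
  ∀ e, e ∈ E ↔ e ∈ F ∧ ∀ w ∈ e, w ∈ V

end LabeledGraph

/-- The raw data `(T, α, r)` of a tree triple; `T` has vertex set `verts` and edge set `edges`,
and `comp` lists the parts of `α`. -/
@[ext] structure TreeTriple where
  verts : Finset ℕ
  edges : Finset (Sym2 ℕ)
  comp : List ℕ
  r : ℕ

namespace TreeTriple

/-- The first part `α₁`. -/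
def first (t : TreeTriple) : ℕ := t.comp.getD 0 0

/-- The last part `α_l`. -/
def last (t : TreeTriple) : ℕ := t.comp.getLastD 0

/-- `α` is a composition of `|T|` and `1 ≤ r ≤ α₁`. -/
def IsValid (t : TreeTriple) : Prop :=
  (∀ p ∈ t.comp, 0 < p) ∧ t.comp.sum = #t.verts ∧ 1 ≤ t.r ∧ t.r ≤ t.first

end TreeTriple

/-- The sign `(-1) ^ ∑ (len α⁽ⁱ⁾ - 1)` of a set of tree triples. -/
def ftSign (𝓕 : Finset TreeTriple) : ℤ := (-1) ^ (∑ t ∈ 𝓕, (t.comp.length - 1))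

/-- The type of a set of tree triples, as the multiset of the parts of the partition. -/
def ftType (𝓕 : Finset TreeTriple) : Multiset ℕ := ∑ t ∈ 𝓕, (t.comp : Multiset ℕ)

/-- `type'`: the first part of the composition of the tree containing the smallest vertex `1`
is left out. -/
def ftType' (𝓕 : Finset TreeTriple) : Multiset ℕ :=
  ∑ t ∈ 𝓕, if 1 ∈ t.verts then (t.comp.tail : Multiset ℕ) else (t.comp : Multiset ℕ)

/-- Every tree triple is unit. -/
def IsUnitFT (𝓕 : Finset TreeTriple) : Prop := ∀ t ∈ 𝓕, t.comp.length = 1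

namespace LabeledGraph

/-- `𝓕` is a forest triple of `G`: a set of tree triples whose trees are exactly the trees of
some non-broken circuit, each tree occurring once. -/
def IsForestTriple (G : LabeledGraph) (𝓕 : Finset TreeTriple) : Prop :=
  ∃ F, G.IsNonBroken F ∧ (∀ t ∈ 𝓕, G.IsComponent F t.verts t.edges ∧ t.IsValid) ∧
    ∀ V E, G.IsComponent F V E → ∃! t, t ∈ 𝓕 ∧ t.verts = V ∧ t.edges = E

theorem finite_isForestTriple (G : LabeledGraph) : {𝓕 | G.IsForestTriple 𝓕}.Finite := by
  have hc : {l : List ℕ | (∀ p ∈ l, 0 < p) ∧ l.sum ≤ G.size}.Finite := by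
    refine (Set.Finite.biUnion (Set.finite_Iic G.size)
      (t := fun m => Set.range (fun c : Composition m => c.blocks))
      (fun m _ => Set.finite_range _)).subset ?_
    rintro l ⟨h1, h2⟩
    simp only [Set.mem_iUnion, Set.mem_Iic, Set.mem_range]
    exact ⟨l.sum, h2, ⟨l, fun {i} hi => h1 i hi, rfl⟩, rfl⟩
  let S : Set TreeTriple := (fun x : Finset ℕ × Finset (Sym2 ℕ) × List ℕ × ℕ =>
    (⟨x.1, x.2.1, x.2.2.1, x.2.2.2⟩ : TreeTriple)) ''
      (((Icc 1 G.size).powerset : Set (Finset ℕ)) ×ˢ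
        ((G.edges.toFinset.powerset : Set (Finset (Sym2 ℕ))) ×ˢ
          ({l : List ℕ | (∀ p ∈ l, 0 < p) ∧ l.sum ≤ G.size} ×ˢ Set.Iic G.size)))
  have hS : S.Finite :=
    ((Finset.finite_toSet _).prod ((Finset.finite_toSet _).prod
      (hc.prod (Set.finite_Iic _)))).image _
  refine (hS.toFinset.powerset.finite_toSet).subset ?_
  rintro 𝓕 ⟨F, hF, ht, -⟩
  simp only [Finset.mem_coe, Finset.mem_powerset]
  intro t h
  obtain ⟨⟨⟨v, hv, hV⟩, hE⟩, h1, h2, h3, h4⟩ := ht t h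
  have hVs : t.verts ⊆ Icc 1 G.size := fun w hw => ((hV w).1 hw).1
  have hcard : #t.verts ≤ G.size := by simpa using Finset.card_le_card hVs
  have hr : t.r ≤ G.size := by
    refine h4.trans (le_trans ?_ (h2.le.trans hcard))
    unfold TreeTriple.first
    cases t.comp with
    | nil => simp
    | cons x l => simp
  rw [Set.Finite.mem_toFinset]
  refine ⟨(t.verts, t.edges, t.comp, t.r), ⟨?_, ?_, ⟨h1, h2.le.trans hcard⟩, hr⟩, rfl⟩
  · exact Finset.mem_coe.2 (Finset.mem_powerset.2 hVs)
  · simp only [Finset.mem_coe, Finset.mem_powerset]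
    exact fun e he => hF.1 ((hE e).1 he).1

/-- `FT(G)`: the finite set of all forest triples of `G`. -/
noncomputable def FT (G : LabeledGraph) : Finset (Finset TreeTriple) :=
  G.finite_isForestTriple.toFinset

end LabeledGraph

/-- A sign-reversing involution on a set `S` of forest triples. -/
structure IsSignReversingInvolution (S : Finset (Finset TreeTriple)) (φ : S → S) : Prop where
  involutive : Function.Involutive φ
  type_eq : ∀ 𝓕 : S, ftType (φ 𝓕) = ftType 𝓕
  sign_ne : ∀ 𝓕 : S, φ 𝓕 ≠ 𝓕 → ftSign (φ 𝓕) ≠ ftSign 𝓕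
  sign_fixed : ∀ 𝓕 : S, φ 𝓕 = 𝓕 → ftSign 𝓕 = 1

/-- A first-preserving involution on a set `S` of forest triples: all fixed points are unit, and
`α₁` and `r` of the tree triple containing the smallest vertex `1` are preserved. -/
structure IsFirstPreservingInvolution (S : Finset (Finset TreeTriple)) (φ : S → S) : Prop
    extends IsSignReversingInvolution S φ where
  unit_fixed : ∀ 𝓕 : S, φ 𝓕 = 𝓕 → IsUnitFT 𝓕
  first_eq : ∀ 𝓕 : S, ∀ t ∈ (𝓕 : Finset TreeTriple), ∀ t' ∈ (φ 𝓕 : Finset TreeTriple),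
    1 ∈ t.verts → 1 ∈ t'.verts → t'.first = t.first ∧ t'.r = t.r

open Classical in
/-- `FT'(C_a + U)`: forest triples of `C_a + U` for which the tree triple `(T, α, r)` with
`a ∈ V(T)` satisfies `E(U) ⊆ E(T)` and `α_l ≥ |U|`. -/
noncomputable def FTprime (a : ℕ) (ha : 2 ≤ a) (U : LabeledGraph) : Finset (Finset TreeTriple) :=
  {𝓕 ∈ ((LabeledGraph.cycle a ha).add U).FT | ∃ t ∈ 𝓕, a ∈ t.verts ∧
    (∀ e ∈ U.edges, LabeledGraph.shiftEdge (a - 1) e ∈ t.edges) ∧ U.size ≤ t.last}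

open Classical in
/-- `FT'⁽ⁱ⁾(C_a + U)`: the members of `FT'(C_a + U)` whose tree triple containing the smallest
vertex has `α₁ = i` and `r = 1`. -/
noncomputable def FTprimeI (a : ℕ) (ha : 2 ≤ a) (U : LabeledGraph) (i : ℕ) :
    Finset (Finset TreeTriple) :=
  {𝓕 ∈ FTprime a ha U | ∃ t ∈ 𝓕, 1 ∈ t.verts ∧ t.first = i ∧ t.r = 1}

open Classical in
/-- The elementary symmetric function `e_(k)` in the variables `x₀, x₁, x₂, …`: the sum of all
squarefree monomials of degree `k` (so `e_(0) = 1`). -/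
noncomputable def elemSym (k : ℕ) : MvPowerSeries ℕ ℤ :=
  fun m => if (∀ j, m j ≤ 1) ∧ m.degree = k then 1 else 0

/-- The elementary symmetric function `e_λ`, with `λ` given by the multiset of its parts;
zero parts have no effect. -/
noncomputable def elemSymPart (l : Multiset ℕ) : MvPowerSeries ℕ ℤ := (l.map elemSym).prod

/-- A homogeneous symmetric function `f` of degree `n` is `e`-positive: its expansion in the
`e_λ`, `λ` a partition of `n`, has non-negative coefficients. -/
def IsEPositive (n : ℕ) (f : MvPowerSeries ℕ ℤ) : Prop :=
  ∃ c : n.Partition → ℕ, f = ∑ l : n.Partition, c l • elemSymPart l.parts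

/-- `B_{a,k}`, as defined from the tree `U` with `k` vertices. -/
noncomputable def BFun (a : ℕ) (ha : 2 ≤ a) (U : LabeledGraph) : MvPowerSeries ℕ ℤ :=
  ∑ 𝓕 ∈ FTprime a ha U, ftSign 𝓕 • elemSymPart (ftType 𝓕)

/-- `B_{a,k}⁽ⁱ⁾`, as defined from the tree `U` with `k` vertices. -/
noncomputable def BFunI (a : ℕ) (ha : 2 ≤ a) (U : LabeledGraph) (i : ℕ) : MvPowerSeries ℕ ℤ :=
  ∑ 𝓕 ∈ FTprimeI a ha U i, ftSign 𝓕 • elemSymPart (ftType' 𝓕)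

namespace Composition

/-- The `j`-th part `α_j` of a composition, counted from `1`; `0` if there is no such part. -/
def part {n : ℕ} (α : Composition n) (j : ℕ) : ℕ := α.blocks.getD (j - 1) 0

/-- The product `(α_{j+1} - 1) ⋯ (α_l - 1)` over all parts after the `j`-th. -/
def prodPredAfter {n : ℕ} (α : Composition n) (j : ℕ) : ℤ :=
  ((α.blocks.drop j).map (fun p : ℕ => (p : ℤ) - 1)).prod

/-- The parts of `(α₁ - 1, α₂, …, α_l)`. -/
def predFirst {n : ℕ} (α : Composition n) : Multiset ℕ :=
  (α.part 1 - 1) ::ₘ (α.blocks.tail : Multiset ℕ)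

end Composition

/-! The involution is not constructed explicitly. Fix the remaining type `ftType'`, the first part
`i` and the root of the tree containing 1. If in each such class the signed count is non-negative
and at most the number of unit forest triples, then the negative members can be paired with positive
ones so that only units stay fixed (`exists_signReversing_involution`). All claims thus follow from
weighted counts in each class.

Underlying forests. Every cycle of `C_a + U` contains all edges of `C_a`, and `(a,1)` is the largest
of these. So a non-broken circuit containing `U` arises by cutting a non-empty set `D` of path edges
`(j,j+1)` and keeping or dropping `(a,1)`. Without `(a,1)` the trees are the intervals between cuts,
the last one absorbing `U`; with it the first and the last interval merge. A forest triple is an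
independent choice of `(α,r)` on each tree, so the sum factors over trees, and summing over `D`
gives coefficients of products of power series (`sum_nonempty_cutLabel`,
`sum_nonempty_cyclicCutLabel`, `sum_tripleWeight`).

Series. A part `p` has weight `w p`, and a composition of length `l` carries `ε ^ (l - 1)`: `ε = -1`
gives signs, `ε = 0` keeps units only. Write `H = ∑ w_p z^p`, `K` for its terms with `p ≥ k`, `D = z
d/dz`, `Q = 1/(1 + H - DH)` and `L = 1/(1 - DH)`. The merged tree with `n - j` of the `n = a + k -
1` vertices has `a - 1 - j = (n - j) - k` positions, whence the operator `D - k`. For a fixed root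
the part of the signed sum with first part `i` is `(i - k)([i ≥ k](1 + H) - K) Q`; the unit count is
`(DK + [i ≥ k](i - k)) L`.

With the `w p` as indeterminates the signed series is visibly non-negative, and `L - Q = L Q H`
makes the difference of unit and signed series non-negative too. With `w p = e_p` the same series
give `B^(i)`. Weighting the first part by `e_i` as well and summing over its `i` roots gives `B`,
which is rewritten by means of `(z - y)(z + y - k) = z(z - k) - y(y - k)`. -/

/-! ### Compositions as lists -/

/-- The compositions of `N`, as lists of positive numbers with sum `N`. -/
noncomputable def compLists (N : ℕ) : Finset (List ℕ) :=
  (univ : Finset (Composition N)).map ⟨Composition.blocks, fun _ _ => Composition.ext⟩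

theorem mem_compLists {N : ℕ} {l : List ℕ} :
    l ∈ compLists N ↔ (∀ p ∈ l, 0 < p) ∧ l.sum = N := by
  simp only [compLists, mem_map, mem_univ, true_and]
  constructor
  · rintro ⟨c, rfl⟩
    exact ⟨fun p hp => c.blocks_pos hp, c.blocks_sum⟩
  · rintro ⟨h1, h2⟩
    exact ⟨⟨l, fun {i} hi => h1 i hi, h2⟩, rfl⟩

theorem sum_composition {M : Type*} [AddCommMonoid M] (N : ℕ) (f : List ℕ → M) :
    ∑ c : Composition N, f c.blocks = ∑ l ∈ compLists N, f l := by
  rw [compLists, sum_map]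
  rfl

/-- Splitting off the first part: this recursion turns sums over compositions into products of power
series. -/
theorem sum_compLists {M : Type*} [AddCommMonoid M] (N : ℕ) (f : List ℕ → M) :
    ∑ l ∈ compLists N, f l = (if N = 0 then f [] else 0) +
      ∑ x ∈ antidiagonal N, if x.1 = 0 then 0 else ∑ l ∈ compLists x.2, f (x.1 :: l) := by
  have h : compLists N = (if N = 0 then {[]} else ∅) ∪
      ((antidiagonal N).filter (fun x => x.1 ≠ 0)).biUnion
        (fun x => (compLists x.2).image (fun l => x.1 :: l)) := by
    ext l
    simp only [mem_union, mem_biUnion, mem_filter, HasAntidiagonal.mem_antidiagonal,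
      mem_image, mem_compLists]
    cases l with
    | nil => by_cases hN : N = 0 <;> simp [hN]; omega
    | cons p t =>
      have : p :: t ∉ (if N = 0 then {[]} else ∅ : Finset (List ℕ)) := by split <;> simp
      simp only [this, false_or, List.mem_cons, forall_eq_or_imp, List.sum_cons, List.cons.injEq]
      constructor
      · rintro ⟨⟨h1, h2⟩, h3⟩
        exact ⟨(p, t.sum), ⟨h3, by simp; omega⟩, t, ⟨h2, rfl⟩, rfl, rfl⟩
      · rintro ⟨x, ⟨h1, h2⟩, t', ⟨h3, h4⟩, rfl, rfl⟩
        exact ⟨⟨by omega, h3⟩, by omega⟩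
  rw [h, sum_union, sum_biUnion, sum_filter]
  · congr 1
    · split <;> simp
    · refine sum_congr rfl fun x _ => ?_
      by_cases hx : x.1 = 0
      · simp [hx]
      · rw [if_pos hx, if_neg hx, sum_image]
        intro l _ l' _ h
        exact (List.cons.inj h).2
  · intro x hx y hy hxy
    simp only [Function.onFun, disjoint_left, mem_image]
    rintro _ ⟨l, _, rfl⟩ ⟨l', _, h⟩
    simp only [coe_filter, Set.mem_ofPred_eq,
      HasAntidiagonal.mem_antidiagonal] at hx hy
    have := (List.cons.inj h).1
    exact hxy (Prod.ext (by omega) (by omega))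
  · rw [disjoint_left]
    intro l hl
    have : l = [] := by
      revert hl
      split <;> simp
    subst this
    simp

/-! ### Generating series of functions on compositions -/

section Series

variable {R : Type*} [CommRing R]

/-- The generating series of a function on compositions. -/
noncomputable def listSeries (f : List ℕ → R) : PowerSeries R :=
  PowerSeries.mk fun N => ∑ l ∈ compLists N, f l

/-- The generating series of a function on positive integers. -/
noncomputable def partSeries (u : ℕ → R) : PowerSeries R :=
  PowerSeries.mk fun p => if p = 0 then 0 else u p

/-- Two summands are needed for the formula for `B`, whose weight in the first two parts is a
difference of products rather than a product. -/
theorem listSeries_eq (f : List ℕ → R) (u₁ u₂ : ℕ → R) (v₁ v₂ : List ℕ → R)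
    (h : ∀ p, 0 < p → ∀ l, f (p :: l) = u₁ p * v₁ l + u₂ p * v₂ l) :
    listSeries f = PowerSeries.C (f []) + partSeries u₁ * listSeries v₁ +
      partSeries u₂ * listSeries v₂ := by
  ext N
  simp only [listSeries, partSeries, PowerSeries.coeff_mk, map_add, PowerSeries.coeff_C,
    PowerSeries.coeff_mul]
  rw [sum_compLists, add_assoc, ← sum_add_distrib]
  congr 1
  refine sum_congr rfl fun x _ => ?_
  split
  · simp
  · rw [mul_sum, mul_sum, ← sum_add_distrib]
    exact sum_congr rfl fun l _ => h _ (by omega) l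

theorem listSeries_eq_mul (f : List ℕ → R) (u : ℕ → R) (v : List ℕ → R)
    (h : ∀ p, 0 < p → ∀ l, f (p :: l) = u p * v l) :
    listSeries f = PowerSeries.C (f []) + partSeries u * listSeries v := by
  rw [listSeries_eq f u 0 v 0 (fun p hp l => by simp [h p hp l])]
  have : partSeries (0 : ℕ → R) = 0 := by ext N; simp [partSeries]
  simp [this]

/-- The generating series of a multiplicative function on compositions. -/
noncomputable def prodSeries (v : ℕ → R) : PowerSeries R :=
  listSeries fun l => (l.map v).prod

theorem prodSeries_eq (v : ℕ → R) : prodSeries v = 1 + partSeries v * prodSeries v := by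
  conv_lhs => rw [prodSeries, listSeries_eq_mul _ v (fun l => (l.map v).prod) (by simp)]
  simp [prodSeries]

/-- The geometric series: a composition is a free sequence of parts. -/
theorem prodSeries_mul (v : ℕ → R) : prodSeries v * (1 - partSeries v) = 1 := by
  linear_combination prodSeries_eq v

/-- A function on compositions, restricted to those with last part at least `k`. -/
def onLast (k : ℕ) (f : List ℕ → R) (l : List ℕ) : R :=
  if l ≠ [] ∧ k ≤ l.getLastD 0 then f l else 0

/-- A function on positive integers, restricted to those which are at least `k`. -/
def onGe (k : ℕ) (u : ℕ → R) (p : ℕ) : R := if k ≤ p then u p else 0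

theorem onLast_cons (k : ℕ) (f : List ℕ → R) (p : ℕ) (l : List ℕ) :
    onLast k f (p :: l) = if l = [] then onGe k (fun p => f [p]) p else
      onLast k (fun l => f (p :: l)) l := by
  cases l with
  | nil => simp [onLast, onGe]
  | cons q l => simp [onLast]

theorem listSeries_nil : listSeries (fun l : List ℕ => if l = [] then (1 : R) else 0) = 1 := by
  rw [listSeries_eq_mul _ 0 0 (by simp)]
  have : partSeries (0 : ℕ → R) = 0 := by ext N; simp [partSeries]
  simp [this]

theorem listSeries_onLast (k : ℕ) (f : List ℕ → R) (u : ℕ → R) (v : ℕ → R)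
    (h : ∀ p l, f (p :: l) = u p * (l.map v).prod) :
    listSeries (onLast k f) = partSeries (onGe k u) +
      partSeries u * listSeries (onLast k fun l => (l.map v).prod) := by
  rw [listSeries_eq _ (onGe k u) u (fun l => if l = [] then 1 else 0)
    (onLast k fun l => (l.map v).prod), listSeries_nil]
  · simp [onLast]
  · intro p _ l
    rw [onLast_cons]
    cases l with
    | nil => simp [onLast, onGe, h]
    | cons q l => simp [onLast, h]

/-- Splitting off the first part gives `S = K + P * S`, where `P` is the series of a part and `K`
that of an admissible last part; multiplying by `1/(1 - P)` solves for `S`. -/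
theorem listSeries_onLast_prod (k : ℕ) (v : ℕ → R) :
    listSeries (onLast k fun l => (l.map v).prod) =
      partSeries (onGe k v) * prodSeries v := by
  have h := listSeries_onLast k (fun l => (l.map v).prod) v v (by simp)
  have h2 := prodSeries_mul v
  linear_combination prodSeries v * h - h2 * listSeries (onLast k fun l => (l.map v).prod)

theorem coeff_listSeries_onLast_of_lt {k N : ℕ} (h : N < k) (f : List ℕ → R) :
    PowerSeries.coeff N (listSeries (onLast k f)) = 0 := by
  rw [listSeries, PowerSeries.coeff_mk]
  refine sum_eq_zero fun l hl => ?_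
  rw [mem_compLists] at hl
  rw [onLast, if_neg]
  rintro ⟨h1, h2⟩
  have : l.getLastD 0 ∈ l := by
    rw [List.getLastD_eq_getLast?, List.getLast?_eq_getLast_of_ne_nil h1]
    simp
  have := List.le_sum_of_mem this
  omega

/-- The operator `z d/dz - k`. -/
noncomputable def degSub (k : ℕ) (f : PowerSeries R) : PowerSeries R :=
  PowerSeries.mk fun N => ((N : R) - k) * PowerSeries.coeff N f

theorem degSub_eq (k : ℕ) (f : PowerSeries R) :
    degSub k f = PowerSeries.X * PowerSeries.derivative R f - (k : PowerSeries R) * f := by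
  ext N
  have hk : (k : PowerSeries R) * f = PowerSeries.C (k : R) * f := by simp
  rw [degSub, PowerSeries.coeff_mk, map_sub, hk, PowerSeries.coeff_C_mul, sub_mul]
  congr 1
  cases N with
  | zero => simp
  | succ N =>
    rw [PowerSeries.coeff_succ_X_mul, PowerSeries.coeff_derivative]
    push_cast
    ring

theorem degSub_add (k : ℕ) (f g : PowerSeries R) : degSub k (f + g) = degSub k f + degSub k g := by
  simp only [degSub_eq, map_add]
  ring

/-- Leibniz rule for `z d/dz - k`; the constant `k` is charged to the first factor only. -/
theorem degSub_mul (k : ℕ) (f g : PowerSeries R) :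
    degSub k (f * g) = degSub k f * g + f * degSub 0 g := by
  simp only [degSub_eq, Derivation.leibniz, smul_eq_mul]
  push_cast
  ring

theorem degSub_partSeries (k : ℕ) (u : ℕ → R) :
    degSub k (partSeries u) = partSeries (fun p => ((p : R) - k) * u p) := by
  ext N
  simp only [degSub, partSeries, PowerSeries.coeff_mk, mul_ite, mul_zero]

theorem partSeries_add (u v : ℕ → R) :
    partSeries (fun p => u p + v p) = partSeries u + partSeries v := by
  ext N
  simp only [partSeries, PowerSeries.coeff_mk, map_add]
  split <;> simp

theorem partSeries_mul_left (c : R) (v : ℕ → R) :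
    partSeries (fun p => c * v p) = PowerSeries.C c * partSeries v := by
  ext N
  simp only [partSeries, PowerSeries.coeff_mk, PowerSeries.coeff_C_mul]
  split <;> simp

end Series

/-! ### Products over the blocks of a labelling -/

section Fibers

variable {R : Type*} [CommRing R] {α : Type*} [DecidableEq α]

/-- The non-empty fibers of `f` on `V`. -/
def fibers (f : ℕ → α) (V : Finset ℕ) : Finset (Finset ℕ) :=
  V.image fun v => {w ∈ V | f w = f v}

/-- The product of `c` over the fibers of `f` on `V`. -/
def fiberProd (c : Finset ℕ → R) (f : ℕ → α) (V : Finset ℕ) : R := ∏ B ∈ fibers f V, c B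

theorem fiberProd_congr {β : Type*} [DecidableEq β] (c : Finset ℕ → R) {f : ℕ → α} {g : ℕ → β}
    {V : Finset ℕ} (h : ∀ u ∈ V, ∀ v ∈ V, f u = f v ↔ g u = g v) :
    fiberProd c f V = fiberProd c g V := by
  have : fibers f V = fibers g V := by
    refine image_congr fun v hv => filter_congr fun w hw => h w hw v hv
  rw [fiberProd, this, fiberProd]

theorem fiberProd_const (c : Finset ℕ → R) {f : ℕ → α} {V : Finset ℕ} (hV : V.Nonempty)
    (h : ∀ u ∈ V, ∀ v ∈ V, f u = f v) : fiberProd c f V = c V := by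
  have : fibers f V = {V} := by
    rw [fibers, image_congr (g := fun _ => V), image_const hV]
    exact fun v hv => filter_true_of_mem fun w hw => h w hw v hv
  rw [fiberProd, this, prod_singleton]

theorem fiberProd_union (c : Finset ℕ → R) {f : ℕ → α} {V W : Finset ℕ}
    (h : ∀ u ∈ V, ∀ v ∈ W, f u ≠ f v) :
    fiberProd c f (V ∪ W) = fiberProd c f V * fiberProd c f W := by
  have h1 : fibers f (V ∪ W) = fibers f V ∪ fibers f W := by
    simp only [fibers, image_union]
    congr 1
    · refine image_congr fun v hv => ?_
      ext w
      simp only [mem_filter, mem_union]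
      exact ⟨fun ⟨h1, h2⟩ => ⟨h1.resolve_right fun h3 => h v hv w h3 h2.symm, h2⟩,
        fun ⟨h1, h2⟩ => ⟨Or.inl h1, h2⟩⟩
    · refine image_congr fun v hv => ?_
      ext w
      simp only [mem_filter, mem_union]
      exact ⟨fun ⟨h1, h2⟩ => ⟨h1.resolve_left fun h3 => h w h3 v hv h2, h2⟩,
        fun ⟨h1, h2⟩ => ⟨Or.inr h1, h2⟩⟩
  rw [fiberProd, h1, prod_union]
  · rfl
  · simp only [fibers, disjoint_left, mem_image]
    rintro _ ⟨v, hv, rfl⟩ ⟨w, hw, h2⟩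
    have : v ∈ ({x ∈ W | f x = f w} : Finset ℕ) := by rw [h2]; simp [hv]
    exact h v hv w hw (mem_filter.1 this).2

end Fibers

/-! ### Sets of cuts on a path -/

/-- Sorts the sets `D` by their smallest element; the empty set stands apart. -/
theorem sum_powerset_Ioo_min {M : Type*} [AddCommMonoid M] (p q : ℕ) (g : Finset ℕ → M) :
    ∑ D ∈ (Ioo p q).powerset, g D =
      g ∅ + ∑ d ∈ Ioo p q, ∑ D ∈ (Ioo d q).powerset, g (insert d D) := by
  obtain h | h := le_or_gt q (p + 1)
  · have : Ioo p q = ∅ := by ext; simp; omega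
    simp [this]
  · have h1 : Ioo p q = insert (p + 1) (Ioo (p + 1) q) := by ext; simp; omega
    have ih := sum_powerset_Ioo_min (p + 1) q g
    rw [h1, sum_powerset_insert (by simp), ih, sum_insert (by simp)]
    abel
termination_by q - p

/-- Sorts the sets `D` by their largest element. -/
theorem sum_powerset_Ioo_max {M : Type*} [AddCommMonoid M] (p q : ℕ) (g : Finset ℕ → M) :
    ∑ D ∈ (Ioo p q).powerset, g D =
      g ∅ + ∑ e ∈ Ioo p q, ∑ D ∈ (Ioo p e).powerset, g (insert e D) := by
  induction q with
  | zero => simp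
  | succ q ih =>
    obtain h | h := le_or_gt q p
    · have : Ioo p (q + 1) = ∅ := by ext; simp; omega
      simp [this]
    · have h1 : Ioo p (q + 1) = insert q (Ioo p q) := by ext; simp; omega
      rw [h1, sum_powerset_insert (by simp), ih, sum_insert (by simp)]
      abel

/-- The number of cuts before `v`. -/
def cutLabel (D : Finset ℕ) (v : ℕ) : ℕ := #{d ∈ D | d < v}

/-- The number of cuts before `v`, counted cyclically. -/
def cyclicCutLabel (D : Finset ℕ) (v : ℕ) : ℕ :=
  if cutLabel D v = #D then 0 else cutLabel D v

theorem cutLabel_insert_of_lt {D : Finset ℕ} {d v : ℕ} (hd : d ∉ D) (h : d < v) :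
    cutLabel (insert d D) v = cutLabel D v + 1 := by
  rw [cutLabel, filter_insert, if_pos h, card_insert_of_notMem (by simp [hd])]
  rfl

theorem cutLabel_insert_of_le {D : Finset ℕ} {d v : ℕ} (h : v ≤ d) :
    cutLabel (insert d D) v = cutLabel D v := by
  rw [cutLabel, filter_insert, if_neg (by omega)]
  rfl

theorem cutLabel_eq_zero {D : Finset ℕ} {v : ℕ} (h : ∀ d ∈ D, v ≤ d) : cutLabel D v = 0 := by
  rw [cutLabel, card_eq_zero, filter_eq_empty_iff]
  exact fun d hd => by have := h d hd; omega

theorem cutLabel_eq_card {D : Finset ℕ} {v : ℕ} (h : ∀ d ∈ D, d < v) : cutLabel D v = #D := by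
  rw [cutLabel, filter_true_of_mem h]

theorem cutLabel_le_card (D : Finset ℕ) (v : ℕ) : cutLabel D v ≤ #D :=
  card_filter_le _ _

/-! ### Sums over cut sets as coefficients of power series -/

section CutSums

variable {R : Type*} [CommRing R]

/-- The smallest cut `d` makes `(p, d]` a block of its own and leaves the same problem on `(d, n]`.
-/
theorem sum_fiberProd_cutLabel (c : Finset ℕ → R) {p a n : ℕ} (hn : a ≤ n + 1)
    (hpn : p < n) :
    ∑ D ∈ (Ioo p a).powerset, fiberProd c (cutLabel D) (Ioc p n) = c (Ioc p n) +
      ∑ d ∈ Ioo p a, c (Ioc p d) *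
        ∑ D ∈ (Ioo d a).powerset, fiberProd c (cutLabel D) (Ioc d n) := by
  rw [sum_powerset_Ioo_min]
  congr 1
  · exact fiberProd_const c (by simpa using hpn) (by simp [cutLabel])
  · refine sum_congr rfl fun d hd => ?_
    rw [mul_sum]
    refine sum_congr rfl fun D hD => ?_
    rw [mem_Ioo] at hd
    have hD' : ∀ x ∈ D, d < x := fun x hx => (mem_Ioo.1 (mem_powerset.1 hD hx)).1
    have hdD : d ∉ D := fun h => lt_irrefl d (hD' d h)
    have hU : Ioc p n = Ioc p d ∪ Ioc d n := by ext; simp; omega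
    have h0 : ∀ u ∈ Ioc p d, cutLabel (insert d D) u = 0 := by
      intro u hu
      rw [mem_Ioc] at hu
      rw [cutLabel_insert_of_le hu.2]
      exact cutLabel_eq_zero fun x hx => by have := hD' x hx; omega
    have h1 : ∀ u ∈ Ioc d n, cutLabel (insert d D) u = cutLabel D u + 1 := by
      intro u hu
      rw [mem_Ioc] at hu
      exact cutLabel_insert_of_lt hdD hu.1
    rw [hU, fiberProd_union, fiberProd_const c (V := Ioc p d)]
    · congr 1
      exact fiberProd_congr c fun u hu v hv => by rw [h1 u hu, h1 v hv]; omega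
    · simpa using hd.1
    · intro u hu v hv
      rw [h0 u hu, h0 v hv]
    · intro u hu v hv
      rw [h0 u hu, h1 v hv]
      omega

/-- The vanishing hypotheses confine the convolution to genuine cuts: `hA` excludes `d = p`, and
`hB` excludes `d ≥ a`. -/
theorem coeff_mul_eq_sum_Ioo (A B : PowerSeries R) {p a n : ℕ} (hp : p ≤ n) (ha : a ≤ n + 1)
    (hA : PowerSeries.coeff 0 A = 0) (hB : ∀ u, u + a ≤ n → PowerSeries.coeff u B = 0) :
    PowerSeries.coeff (n - p) (A * B) =
      ∑ d ∈ Ioo p a, PowerSeries.coeff (d - p) A * PowerSeries.coeff (n - d) B := by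
  rw [PowerSeries.coeff_mul, Finset.Nat.sum_antidiagonal_eq_sum_range_succ_mk]
  symm
  refine sum_of_injOn (fun d => d - p) ?_ ?_ ?_ ?_
  · intro x hx y hy h
    simp only [coe_Ioo, Set.mem_Ioo] at hx hy h
    omega
  · intro x hx
    simp only [coe_Ioo, Set.mem_Ioo] at hx
    simp only [coe_range, Set.mem_Iio]
    omega
  · intro i hi hi'
    rw [mem_range] at hi
    obtain rfl | h0 := Nat.eq_zero_or_pos i
    · simp [hA]
    · rw [hB, mul_zero]
      by_contra h
      refine hi' ⟨p + i, ?_, by simp⟩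
      simp only [coe_Ioo, Set.mem_Ioo]
      omega
  · intro d hd
    rw [mem_Ioo] at hd
    simp only
    congr 3
    omega

/-- Both sides satisfy the recursion over the first cut, which for the series reads `E * m = E + C *
(E * m)`. Here `E` weighs the block that ends at `n`, `C` the blocks before it, and `m = 1/(1 - C)`.
-/
theorem sum_fiberProd_cutLabel_eq_coeff (c : Finset ℕ → R) (C E m : PowerSeries R) {a n : ℕ}
    (han : a ≤ n) (hC0 : PowerSeries.coeff 0 C = 0) (hm : m * (1 - C) = 1)
    (hE : ∀ u, u + a ≤ n → PowerSeries.coeff u E = 0)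
    (hC : ∀ p d, 0 < p → p < d → d < a → c (Ioc p d) = PowerSeries.coeff (d - p) C)
    (hcE : ∀ p, 0 < p → p < a → c (Ioc p n) = PowerSeries.coeff (n - p) E)
    {p : ℕ} (hp0 : 0 < p) (hp : p < a) :
    ∑ D ∈ (Ioo p a).powerset, fiberProd c (cutLabel D) (Ioc p n) =
      PowerSeries.coeff (n - p) (E * m) := by
  have hEm : E * m = E + C * (E * m) := by linear_combination E * hm
  have hz : ∀ u, u + a ≤ n → PowerSeries.coeff u (E * m) = 0 := by
    intro u hu
    rw [PowerSeries.coeff_mul]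
    refine sum_eq_zero fun x hx => ?_
    rw [HasAntidiagonal.mem_antidiagonal] at hx
    rw [hE _ (by omega), zero_mul]
  rw [sum_fiberProd_cutLabel c (by omega) (by omega), hEm, map_add, hcE p hp0 hp,
    coeff_mul_eq_sum_Ioo _ _ (by omega) (by omega) hC0 hz]
  congr 1
  refine sum_congr rfl fun d hd => ?_
  rw [mem_Ioo] at hd
  rw [hC p d hp0 hd.1 hd.2]
  rw [sum_fiberProd_cutLabel_eq_coeff c C E m han hC0 hm hE hC hcE (by omega) hd.2]
termination_by a - p
decreasing_by
  have := mem_Ioo.1 (by assumption : _ ∈ Ioo _ _)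
  omega

theorem sum_powerset_nonempty (s : Finset ℕ) (g : Finset ℕ → R) :
    ∑ D ∈ s.powerset with D.Nonempty, g D = ∑ D ∈ s.powerset, g D - g ∅ := by
  have h : (s.powerset.filter fun D => D.Nonempty) = s.powerset.erase ∅ := by
    ext D
    simp [nonempty_iff_ne_empty, and_comm]
  rw [h, eq_sub_iff_add_eq, sum_erase_add _ _ (by simp)]

/-- The block containing 1 contributes `F`, the one containing `n` contributes `E`, and the free
sequence of blocks between them contributes `m`. -/
theorem sum_nonempty_cutLabel (c : Finset ℕ → R) (C E F m : PowerSeries R) {a n : ℕ}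
    (ha : 0 < a) (han : a ≤ n) (hC0 : PowerSeries.coeff 0 C = 0) (hm : m * (1 - C) = 1)
    (hE : ∀ u, u + a ≤ n → PowerSeries.coeff u E = 0)
    (hF : PowerSeries.coeff 0 F = 0)
    (hC : ∀ p d, 0 < p → p < d → d < a → c (Ioc p d) = PowerSeries.coeff (d - p) C)
    (hcE : ∀ p, 0 < p → p < a → c (Ioc p n) = PowerSeries.coeff (n - p) E)
    (hcF : ∀ d, 0 < d → d < a → c (Ioc 0 d) = PowerSeries.coeff d F) :
    ∑ D ∈ (Ioo 0 a).powerset with D.Nonempty, fiberProd c (cutLabel D) (Ioc 0 n) =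
      PowerSeries.coeff n (F * (E * m)) := by
  have hz : ∀ u, u + a ≤ n → PowerSeries.coeff u (E * m) = 0 := by
    intro u hu
    rw [PowerSeries.coeff_mul]
    refine sum_eq_zero fun x hx => ?_
    rw [HasAntidiagonal.mem_antidiagonal] at hx
    rw [hE _ (by omega), zero_mul]
  rw [sum_powerset_nonempty, sum_fiberProd_cutLabel c (by omega) (by omega),
    fiberProd_const c (by simp; omega) (by simp [cutLabel]), add_sub_cancel_left]
  have := coeff_mul_eq_sum_Ioo F (E * m) (p := 0) (a := a) (n := n) (by omega) (by omega) hF hz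
  rw [Nat.sub_zero] at this
  rw [this]
  refine sum_congr rfl fun d hd => ?_
  rw [mem_Ioo] at hd
  rw [hcF d hd.1 hd.2, Nat.sub_zero,
    sum_fiberProd_cutLabel_eq_coeff c C E m han hC0 hm hE hC hcE hd.1 hd.2]

/-- With `s` the smallest and `e` the largest cut, everything outside `(s, e]` forms a single block
through the edge `(a, 1)`; the cuts in `D` only divide `(s, e]`. -/
theorem fiberProd_cyclicCutLabel (c : Finset ℕ → R) {s e n : ℕ} {D : Finset ℕ} (hs : 0 < s)
    (hse : s < e) (hen : e < n) (hD : D ⊆ Ioo s e) :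
    fiberProd c (cyclicCutLabel (insert s (insert e D))) (Ioc 0 n) =
      c (Ioc 0 s ∪ Ioc e n) * fiberProd c (cutLabel D) (Ioc s e) := by
  have hD' : ∀ x ∈ D, s < x ∧ x < e := fun x hx => mem_Ioo.1 (hD hx)
  have heD : e ∉ D := fun h => lt_irrefl e (hD' e h).2
  have hsD : s ∉ insert e D := by
    rw [mem_insert, not_or]
    exact ⟨hse.ne, fun h => lt_irrefl s (hD' s h).1⟩
  have hcard : #(insert s (insert e D)) = #D + 2 := by
    rw [card_insert_of_notMem hsD, card_insert_of_notMem heD]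
  have h0 : ∀ u ∈ Ioc 0 s ∪ Ioc e n, cyclicCutLabel (insert s (insert e D)) u = 0 := by
    intro u hu
    rw [mem_union, mem_Ioc, mem_Ioc] at hu
    rw [cyclicCutLabel]
    split
    · rfl
    · rename_i h
      rcases hu with hu | hu
      · refine cutLabel_eq_zero fun d hd => ?_
        simp only [mem_insert] at hd
        rcases hd with rfl | rfl | hd
        · omega
        · omega
        · have := hD' d hd
          omega
      · refine absurd (cutLabel_eq_card fun d hd => ?_) h
        simp only [mem_insert] at hd
        rcases hd with rfl | rfl | hd
        · omega
        · omega
        · have := hD' d hd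
          omega
  have h1 : ∀ u ∈ Ioc s e, cyclicCutLabel (insert s (insert e D)) u = cutLabel D u + 1 := by
    intro u hu
    rw [mem_Ioc] at hu
    have h2 : cutLabel (insert s (insert e D)) u = cutLabel D u + 1 := by
      rw [cutLabel_insert_of_lt hsD hu.1, cutLabel_insert_of_le hu.2]
    have h3 := cutLabel_le_card D u
    rw [cyclicCutLabel, h2, hcard, if_neg (by omega)]
  have hU : Ioc 0 n = (Ioc 0 s ∪ Ioc e n) ∪ Ioc s e := by ext; simp; omega
  rw [hU, fiberProd_union, fiberProd_const c (V := Ioc 0 s ∪ Ioc e n)]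
  · congr 1
    exact fiberProd_congr c fun u hu v hv => by rw [h1 u hu, h1 v hv]; omega
  · exact ⟨s, by simp; omega⟩
  · intro u hu v hv
    rw [h0 u hu, h0 v hv]
  · intro u hu v hv
    rw [h0 u hu, h1 v hv]
    omega

/-- There are `a - 1 - j` pairs `s ≤ e` of cut positions with `e - s = j`. -/
theorem sum_Ioo_sum_Ico (f : ℕ → R) (a : ℕ) :
    ∑ s ∈ Ioo 0 a, ∑ e ∈ Ico s a, f (e - s) = ∑ j ∈ range a, ((a : R) - 1 - j) * f j := by
  induction a with
  | zero => simp
  | succ a ih =>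
    obtain rfl | ha := Nat.eq_zero_or_pos a
    · have : Ioo 0 1 = (∅ : Finset ℕ) := rfl
      simp [this]
    have h1 : Ioo 0 (a + 1) = insert a (Ioo 0 a) := by ext; simp; omega
    have h2 : ∀ s ∈ Ioo 0 a, ∑ e ∈ Ico s (a + 1), f (e - s) =
        ∑ e ∈ Ico s a, f (e - s) + f (a - s) := by
      intro s hs
      rw [mem_Ioo] at hs
      rw [sum_Ico_succ_top hs.2.le]
    have h3 : ∑ s ∈ Ioo 0 a, f (a - s) + f 0 = ∑ j ∈ range a, f j := by
      have : range a = insert 0 (Ioo 0 a) := by ext; simp; omega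
      rw [this, sum_insert (by simp), add_comm]
      congr 1
      refine sum_nbij' (fun s => a - s) (fun s => a - s) ?_ ?_ ?_ ?_ ?_ <;>
        simp only [mem_Ioo] <;> intros <;> first | omega | trivial
    rw [h1, sum_insert (by simp), sum_congr rfl h2, sum_add_distrib, ih, sum_range_succ]
    have h4 : ∑ e ∈ Ico a (a + 1), f (e - a) = f 0 := by simp
    rw [h4]
    have h5 : ∑ j ∈ range a, (((a + 1 : ℕ) : R) - 1 - j) * f j =
        ∑ j ∈ range a, ((a : R) - 1 - j) * f j + ∑ j ∈ range a, f j := by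
      rw [← sum_add_distrib]
      exact sum_congr rfl fun j _ => by push_cast; ring
    rw [h5, ← h3]
    push_cast
    ring

/-- If the extreme cuts differ by `j`, the merged block has `n - j` vertices and `a - 1 - j`
positions. Since `a + k = n + 1`, this multiplicity is `(n - j) - k`, which depends only on the size
of the block, so it acts on `F` as `degSub k`. -/
theorem sum_nonempty_cyclicCutLabel (c : Finset ℕ → R) (C F m : PowerSeries R) {a k n : ℕ}
    (hk : 0 < k) (han : a + k = n + 1) (hC0 : PowerSeries.coeff 0 C = 0)
    (hm : m * (1 - C) = 1) (hF : ∀ u, u < k → PowerSeries.coeff u F = 0)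
    (hC : ∀ p d, 0 < p → p < d → d < a → c (Ioc p d) = PowerSeries.coeff (d - p) C)
    (hcF : ∀ s e, 0 < s → s ≤ e → e < a →
      c (Ioc 0 s ∪ Ioc e n) = PowerSeries.coeff (n - (e - s)) F) :
    ∑ D ∈ (Ioo 0 a).powerset with D.Nonempty, fiberProd c (cyclicCutLabel D) (Ioc 0 n) =
      PowerSeries.coeff n (degSub k F * m) := by
  have hm0 : m = 1 + C * m := by linear_combination hm
  have hm00 : PowerSeries.coeff 0 m = 1 := by
    rw [PowerSeries.coeff_zero_eq_constantCoeff] at hC0 ⊢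
    rw [hm0, map_add, map_mul, hC0]
    simp
  have key : ∀ s ∈ Ioo 0 a, ∑ D ∈ (Ioo s a).powerset,
      fiberProd c (cyclicCutLabel (insert s D)) (Ioc 0 n) =
      ∑ e ∈ Ico s a, PowerSeries.coeff (n - (e - s)) F * PowerSeries.coeff (e - s) m := by
    intro s hs
    rw [mem_Ioo] at hs
    have hI : Ico s a = insert s (Ioo s a) := by ext; simp; omega
    -- The term `e = s` stands for a single cut, where the merged block is everything; it matches
    -- the constant term 1 of `m`.
    rw [sum_powerset_Ioo_max, hI, sum_insert (by simp), Nat.sub_self, hm00, Nat.sub_zero, mul_one]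
    congr 1
    · have h := hcF s s hs.1 le_rfl hs.2
      rw [Nat.sub_self, Nat.sub_zero] at h
      have hU : Ioc 0 s ∪ Ioc s n = Ioc 0 n := by ext; simp; omega
      rw [← h, hU]
      refine fiberProd_const c (by simp; omega) ?_
      have : ∀ u, cyclicCutLabel {s} u = 0 := by
        intro u
        have := cutLabel_le_card {s} u
        rw [cyclicCutLabel]
        split
        · rfl
        · simp at *
          omega
      simp [this]
    · refine sum_congr rfl fun e he => ?_
      rw [mem_Ioo] at he
      rw [sum_congr rfl fun D hD => fiberProd_cyclicCutLabel c hs.1 he.1 (by omega)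
        (mem_powerset.1 hD), ← mul_sum, hcF s e hs.1 he.1.le he.2]
      congr 1
      -- The interval from `s` to `e` contains neither 1 nor `a`, so its last block has weight `C`
      -- too; `C * m` and `m` differ only in the constant term.
      rw [sum_fiberProd_cutLabel_eq_coeff c C C m le_rfl hC0 hm ?_ ?_ ?_ hs.1 he.1]
      · conv_rhs => rw [hm0]
        rw [map_add, PowerSeries.coeff_one, if_neg (by omega), zero_add]
      · intro u hu
        have : u = 0 := by omega
        rw [this, hC0]
      · exact fun p d h1 h2 h3 => hC p d h1 h2 (by omega)
      · exact fun p h1 h2 => hC p e h1 h2 he.2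
  have h1 := sum_Ioo_sum_Ico
    (fun j => PowerSeries.coeff (n - j) F * PowerSeries.coeff j m) a
  rw [sum_powerset_nonempty, sum_powerset_Ioo_min, add_sub_cancel_left, sum_congr rfl key, h1,
    mul_comm, PowerSeries.coeff_mul, Finset.Nat.sum_antidiagonal_eq_sum_range_succ_mk]
  have h2 : range a ⊆ range (n + 1) := range_subset_range.2 (by omega)
  rw [← sum_subset h2]
  · refine sum_congr rfl fun j hj => ?_
    rw [mem_range] at hj
    simp only [degSub, PowerSeries.coeff_mk]
    have h3 : ((n - j : ℕ) : R) - k = (a : R) - 1 - j := by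
      have : ((n - j + j + 1 : ℕ) : R) = ((a + k : ℕ) : R) := by congr 1; omega
      push_cast at this
      linear_combination this
    rw [h3]
    ring
  -- For `j ≥ a` the merged block would have fewer than `k` vertices, where `F` vanishes.
  · intro j hj hj'
    rw [mem_range] at hj hj'
    simp only [degSub, PowerSeries.coeff_mk]
    rw [hF _ (by omega)]
    simp

end CutSums

/-! ### Reachability invariants and cycles -/

open SimpleGraph in
theorem eq_of_reachable_fromEdgeSet {α : Type*} {S : Set (Sym2 ℕ)} (f : ℕ → α)
    (h : ∀ x y, s(x, y) ∈ S → f x = f y) {u v : ℕ} (huv : (fromEdgeSet S).Reachable u v) :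
    f u = f v := by
  obtain ⟨p⟩ := huv
  induction p with
  | nil => rfl
  | cons hadj _ ih =>
    rw [fromEdgeSet_adj] at hadj
    exact (h _ _ hadj.1).trans ih

open SimpleGraph in
/-- Every edge of a cycle is crossed by another edge of the cycle in any vertex bipartition that
separates its ends. -/
theorem SimpleGraph.Walk.IsCycle.exists_crossing {G : SimpleGraph ℕ} {v : ℕ} {c : G.Walk v v}
    (hc : c.IsCycle) {x y : ℕ} (hxy : s(x, y) ∈ c.edges) (f : ℕ → Prop) (hf : ¬(f x ↔ f y)) :
    ∃ z w, s(z, w) ∈ c.edges ∧ s(z, w) ≠ s(x, y) ∧ ¬(f z ↔ f w) := by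
  by_contra! hcon
  have h1 : ∀ e ∈ c.edges, e ∈ (fromEdgeSet {e | e ∈ c.edges}).edgeSet := by
    intro e he
    rw [edgeSet_fromEdgeSet]
    exact ⟨he, G.not_isDiag_of_mem_edgeSet (c.edges_subset_edgeSet he)⟩
  -- An edge of a cycle is not a bridge: its ends stay connected through the other edges of the
  -- cycle, along which `f` would be constant.
  have h2 := (adj_and_reachable_delete_edges_iff_exists_cycle
    (G := fromEdgeSet {e | e ∈ c.edges}) (v := x) (w := y)).2
    ⟨v, c.transfer _ h1, hc.transfer h1, by simpa using hxy⟩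
  have h3 : (fromEdgeSet {e | e ∈ c.edges}).deleteEdges {s(x, y)} =
      fromEdgeSet ({e | e ∈ c.edges} \ {s(x, y)}) := by
    rw [deleteEdges, fromEdgeSet_sdiff]
  rw [h3] at h2
  exact hf (eq_of_reachable_fromEdgeSet f
    (fun z w hzw => propext (hcon z w hzw.1 hzw.2)) h2.2).to_iff

/-! ### Non-broken circuits of `C_a + U` containing `U`, and their components -/

namespace LabeledGraph

variable {a : ℕ} {ha : 2 ≤ a} {U : LabeledGraph}

theorem size_cycle_add : ((cycle a ha).add U).size = a + U.size - 1 := rfl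

theorem mem_edges_cycle {e : Sym2 ℕ} :
    e ∈ (cycle a ha).edges ↔ (∃ j, 0 < j ∧ j < a ∧ e = s(j, j + 1)) ∨ e = s(a, 1) := by
  simp only [cycle, List.mem_append, List.mem_map, List.mem_range'_1]
  constructor
  · rintro (⟨j, hj, rfl⟩ | h)
    · exact Or.inl ⟨j, by omega, by omega, rfl⟩
    · split at h
      · simp at h
      · simp only [List.mem_singleton] at h
        exact Or.inr h
  · rintro (⟨j, h1, h2, rfl⟩ | rfl)
    · exact Or.inl ⟨j, by omega, rfl⟩
    · split
      · subst a
        exact Or.inl ⟨1, by omega, Sym2.eq_swap⟩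
      · simp

theorem mem_edges_cycle_add {e : Sym2 ℕ} :
    e ∈ ((cycle a ha).add U).edges ↔ (∃ j, 0 < j ∧ j < a ∧ e = s(j, j + 1)) ∨ e = s(a, 1) ∨
      e ∈ U.edges.map (shiftEdge (a - 1)) := by
  have : ((cycle a ha).add U).edges = (cycle a ha).edges ++ U.edges.map (shiftEdge (a - 1)) := rfl
  rw [this, List.mem_append, mem_edges_cycle, or_assoc]

theorem mem_shift_edges (ha : 0 < a) {x y : ℕ} :
    s(x, y) ∈ U.edges.map (shiftEdge (a - 1)) ↔
      a ≤ x ∧ a ≤ y ∧ s(x - (a - 1), y - (a - 1)) ∈ U.edges := by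
  rw [List.mem_map]
  constructor
  · rintro ⟨g, hg, h⟩
    induction g using Sym2.ind with
    | _ z w =>
      have hz := U.edges_mem _ hg z (by simp)
      have hw := U.edges_mem _ hg w (by simp)
      simp only [shiftEdge, Sym2.map_mk, Sym2.eq_iff] at h
      rcases h with ⟨rfl, rfl⟩ | ⟨rfl, rfl⟩
      · refine ⟨by omega, by omega, ?_⟩
        simpa using hg
      · refine ⟨by omega, by omega, ?_⟩
        rw [Sym2.eq_swap]
        simpa using hg
  · rintro ⟨hx, hy, h⟩
    refine ⟨_, h, ?_⟩
    simp only [shiftEdge, Sym2.map_mk]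
    rw [Nat.sub_add_cancel (by omega), Nat.sub_add_cancel (by omega)]

theorem le_of_mem_shift_edges (ha : 0 < a) {x y : ℕ}
    (h : s(x, y) ∈ U.edges.map (shiftEdge (a - 1))) :
    a ≤ x ∧ a ≤ y ∧ x ≠ y ∧ x ≤ a + U.size - 1 ∧ y ≤ a + U.size - 1 := by
  obtain ⟨hx, hy, h⟩ := (mem_shift_edges ha).1 h
  have h1 := U.edges_mem _ h _ (Sym2.mem_mk_left _ _)
  have h2 := U.edges_mem _ h _ (Sym2.mem_mk_right _ _)
  have h3 := U.edges_loopless _ h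
  rw [Sym2.mk_isDiag_iff] at h3
  omega

open SimpleGraph in
theorem reachable_of_shift_edges_subset (hU : U.IsTree) (ha : 0 < a) {F : Set (Sym2 ℕ)}
    (hF : ∀ e ∈ U.edges.map (shiftEdge (a - 1)), e ∈ F) {v : ℕ} (h1 : a ≤ v)
    (h2 : v ≤ a + U.size - 1) : (fromEdgeSet F).Reachable a v := by
  let φ : U.toSimpleGraph.induce (Set.Icc 1 U.size) →g fromEdgeSet F :=
    { toFun := fun x => x + (a - 1)
      map_rel' := by
        rintro ⟨x, hx⟩ ⟨y, hy⟩ hxy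
        simp only [comap_adj, Function.Embedding.subtype_apply, toSimpleGraph, fromEdgeSet_adj,
          Set.mem_ofPred_eq] at hxy
        rw [fromEdgeSet_adj]
        refine ⟨hF _ ((mem_shift_edges ha).2 ?_), by simpa using hxy.2⟩
        rw [Set.mem_Icc] at hx hy
        refine ⟨by simp only; omega, by simp only; omega, ?_⟩
        simpa using hxy.1 }
  have hs := U.size_pos
  have := (hU.connected.preconnected ⟨1, by simp; omega⟩
    ⟨v - (a - 1), by simp only [Set.mem_Icc]; omega⟩).map φ
  have e1 : φ ⟨1, by simp; omega⟩ = a := by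
    change 1 + (a - 1) = a
    omega
  have e2 : φ ⟨v - (a - 1), by simp only [Set.mem_Icc]; omega⟩ = v := by
    change v - (a - 1) + (a - 1) = v
    omega
  rwa [e1, e2] at this

-- Otherwise shifting the labels back would carry the cycle into the tree `U`.
open SimpleGraph in
theorem exists_edge_notMem_shift_edges (hU : U.IsTree) (ha : 0 < a) {G : SimpleGraph ℕ} {v : ℕ}
    {c : G.Walk v v} (hc : c.IsCycle) :
    ∃ e ∈ c.edges, e ∉ U.edges.map (shiftEdge (a - 1)) := by
  by_contra! hcon
  set S := {e | e ∈ U.edges.map (shiftEdge (a - 1))} with hS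
  have h1 : ∀ e ∈ c.edges, e ∈ (fromEdgeSet S).edgeSet := by
    intro e he
    rw [edgeSet_fromEdgeSet]
    exact ⟨hcon e he, G.not_isDiag_of_mem_edgeSet (c.edges_subset_edgeSet he)⟩
  have hc' := hc.transfer h1
  set c' := c.transfer _ h1
  have hsupp : ∀ x ∈ c'.support, x ∈ Set.Icc a (a + U.size - 1) := by
    intro x hx
    rw [Walk.mem_support_iff_exists_mem_edges_of_not_nil hc'.not_nil] at hx
    obtain ⟨e, he, hxe⟩ := hx
    induction e using Sym2.ind with
    | _ z w =>
      have h2 := le_of_mem_shift_edges ha (hcon _ (by simpa [c'] using he))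
      rw [Sym2.mem_iff] at hxe
      rw [Set.mem_Icc]
      omega
  let φ : (fromEdgeSet S).induce (Set.Icc a (a + U.size - 1)) →g
      U.toSimpleGraph.induce (Set.Icc 1 U.size) :=
    { toFun := fun x => ⟨x - (a - 1), by
        have := x.2
        rw [Set.mem_Icc] at this ⊢
        omega⟩
      map_rel' := by
        rintro ⟨x, hx⟩ ⟨y, hy⟩ hxy
        simp only [comap_adj, Function.Embedding.subtype_apply, fromEdgeSet_adj] at hxy
        have h2 := (mem_shift_edges ha).1 hxy.1
        simp only [comap_adj, Function.Embedding.subtype_apply, toSimpleGraph, fromEdgeSet_adj,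
          Set.mem_ofPred_eq]
        exact ⟨h2.2.2, by omega⟩ }
  have hφ : Function.Injective φ := by
    rintro ⟨x, hx⟩ ⟨y, hy⟩ hxy
    have : x - (a - 1) = y - (a - 1) := congrArg Subtype.val hxy
    rw [Set.mem_Icc] at hx hy
    ext
    simp only
    omega
  have hac := hU.isAcyclic.comap φ hφ
  refine hac (c'.induce _ hsupp) ?_
  rw [← Walk.isCycle_map_iff_of_injective (f := (Embedding.induce _).toHom)
    (Embedding.induce (G := fromEdgeSet S) (Set.Icc a (a + U.size - 1))).injective,
    Walk.map_induce]
  exact hc'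

/-- The bipartition `v ≤ j` is crossed only by `(j, j + 1)` and `(a, 1)`. A cycle has an edge
outside `U`, hence contains `(a, 1)`, hence every path edge. For `a = 2` the two crossing edges
coincide and there is no cycle. -/
theorem mem_edges_of_isCycle (hU : U.IsTree) {v : ℕ}
    {c : ((cycle a ha).add U).toSimpleGraph.Walk v v} (hc : c.IsCycle) :
    (∀ j, 0 < j → j < a → s(j, j + 1) ∈ c.edges) ∧ s(a, 1) ∈ c.edges ∧ a ≠ 2 := by
  have hG : ∀ e ∈ c.edges, (∃ j, 0 < j ∧ j < a ∧ e = s(j, j + 1)) ∨ e = s(a, 1) ∨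
      e ∈ U.edges.map (shiftEdge (a - 1)) := by
    intro e he
    have := c.edges_subset_edgeSet he
    rw [toSimpleGraph, SimpleGraph.edgeSet_fromEdgeSet] at this
    exact mem_edges_cycle_add.1 this.1
  obtain ⟨e₁, he₁, heU⟩ := exists_edge_notMem_shift_edges (a := a) hU (by omega) hc
  have hU' : ∀ z w, s(z, w) ∈ U.edges.map (shiftEdge (a - 1)) → a ≤ z ∧ a ≤ w := by
    intro z w h
    have := le_of_mem_shift_edges (a := a) (by omega) h
    omega
  have hlast : s(a, 1) ∈ c.edges := by
    rcases hG e₁ he₁ with ⟨j, hj, hja, rfl⟩ | rfl | h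
    · obtain ⟨z, w, hzw, hne, hf⟩ := hc.exists_crossing he₁ (fun v => v ≤ j) (by simp)
      rcases hG _ hzw with ⟨l, hl, hla, h⟩ | h | h
      · have hlj : l ≠ j := by
          rintro rfl
          exact hne h
        rw [Sym2.eq_iff] at h
        omega
      · rwa [← h]
      · have := hU' z w h
        omega
    · exact he₁
    · exact absurd h heU
  have hpath : ∀ i, 0 < i → i < a → s(i, i + 1) ∈ c.edges ∧ s(i, i + 1) ≠ s(a, 1) := by
    intro i hi hia
    obtain ⟨z, w, hzw, hne, hf⟩ := hc.exists_crossing hlast (fun v => v ≤ i) (by omega)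
    rcases hG _ hzw with ⟨l, hl, hla, h⟩ | h | h
    · have hli : l = i := by
        rw [Sym2.eq_iff] at h
        omega
      subst hli
      rw [h] at hzw hne
      exact ⟨hzw, hne⟩
    · exact absurd h hne
    · have := hU' z w h
      omega
  refine ⟨fun j h1 h2 => (hpath j h1 h2).1, hlast, ?_⟩
  rintro rfl
  exact (hpath 1 (by omega) (by omega)).2 Sym2.eq_swap

/-- The spanning subgraph of `C_a + U` that contains `U`, the edges `(j, j + 1)` of `C_a` for
`j ∉ D`, and the edge `(a, 1)` if `b` is true. -/
def cutEdges (a : ℕ) (U : LabeledGraph) (b : Bool) (D : Finset ℕ) : Finset (Sym2 ℕ) :=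
  (Ioo 0 a \ D).image (fun j => s(j, j + 1)) ∪ (if b then {s(a, 1)} else ∅) ∪
    (U.edges.map (shiftEdge (a - 1))).toFinset

theorem mem_cutEdges {b : Bool} {D : Finset ℕ} {e : Sym2 ℕ} :
    e ∈ cutEdges a U b D ↔ (∃ j, 0 < j ∧ j < a ∧ j ∉ D ∧ e = s(j, j + 1)) ∨
      (b = true ∧ e = s(a, 1)) ∨ e ∈ U.edges.map (shiftEdge (a - 1)) := by
  rw [cutEdges, mem_union, mem_union, mem_image, List.mem_toFinset, or_assoc]
  refine or_congr ⟨?_, ?_⟩ (or_congr ?_ Iff.rfl)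
  · rintro ⟨j, hj, rfl⟩
    rw [mem_sdiff, mem_Ioo] at hj
    exact ⟨j, hj.1.1, hj.1.2, hj.2, rfl⟩
  · rintro ⟨j, h1, h2, h3, rfl⟩
    exact ⟨j, by simp [h1, h2, h3], rfl⟩
  · cases b <;> simp

/-- For `a = 2` the edge `(1, 2)` is also `(a, 1)` and can enter through `b`, so that case is
excluded. -/
theorem path_mem_cutEdges (ha' : a ≠ 2) {b : Bool} {D : Finset ℕ} {j : ℕ} (h0 : 0 < j)
    (hj : j < a) : s(j, j + 1) ∈ cutEdges a U b D ↔ j ∉ D := by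
  rw [mem_cutEdges]
  constructor
  · rintro (⟨i, h1, h2, h3, h⟩ | ⟨_, h⟩ | h)
    · rw [Sym2.eq_iff] at h
      have : j = i := by omega
      rwa [this]
    · rw [Sym2.eq_iff] at h
      omega
    · have := le_of_mem_shift_edges (by omega) h
      omega
  · exact fun h => Or.inl ⟨j, h0, hj, h, rfl⟩

/-- Non-emptiness matters for `a = 2`: it forces `1 ∈ D`, so that `b` alone governs the single edge
of `C_2`. -/
theorem last_mem_cutEdges (ha : 2 ≤ a) {b : Bool} {D : Finset ℕ} (hD : D ⊆ Ioo 0 a)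
    (hne : D.Nonempty) : s(a, 1) ∈ cutEdges a U b D ↔ b = true := by
  rw [mem_cutEdges]
  constructor
  · rintro (⟨i, h1, h2, h3, h⟩ | ⟨h, _⟩ | h)
    · rw [Sym2.eq_iff] at h
      obtain ⟨d, hd⟩ := hne
      have := mem_Ioo.1 (hD hd)
      have : d = i := by omega
      subst this
      exact absurd hd h3
    · exact h
    · have := le_of_mem_shift_edges (by omega) h
      omega
  · exact fun h => Or.inr (Or.inl ⟨h, rfl⟩)

theorem cutEdges_injective (ha : 2 ≤ a) {b b' : Bool} {D D' : Finset ℕ} (hD : D ⊆ Ioo 0 a)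
    (hne : D.Nonempty) (hD' : D' ⊆ Ioo 0 a) (hne' : D'.Nonempty)
    (h : cutEdges a U b D = cutEdges a U b' D') : b = b' ∧ D = D' := by
  constructor
  · have h1 := last_mem_cutEdges (U := U) ha (b := b) hD hne
    rw [h, last_mem_cutEdges ha hD' hne'] at h1
    exact Bool.eq_iff_iff.2 h1.symm
  · by_cases ha' : a = 2
    · subst ha'
      have : Ioo 0 2 = {1} := rfl
      rw [this, subset_singleton_iff] at hD hD'
      rw [hD.resolve_left hne.ne_empty, hD'.resolve_left hne'.ne_empty]
    · ext j
      by_cases hj : j ∈ Ioo 0 a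
      · rw [mem_Ioo] at hj
        have h1 := path_mem_cutEdges (U := U) ha' (b := b) (D := D) hj.1 hj.2
        rw [h, path_mem_cutEdges ha' hj.1 hj.2] at h1
        exact (not_iff_not.1 h1).symm
      · exact ⟨fun h => absurd (hD h) hj, fun h => absurd (hD' h) hj⟩

theorem idxOf_path_lt {j : ℕ} (h0 : 0 < j) (hj : j < a) :
    ((cycle a ha).add U).edges.idxOf s(j, j + 1) < a - 1 := by
  have h : ((cycle a ha).add U).edges = (List.range' 1 (a - 1)).map (fun i => s(i, i + 1)) ++
      ((if a = 2 then [] else [s(a, 1)]) ++ U.edges.map (shiftEdge (a - 1))) := by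
    rw [← List.append_assoc]
    rfl
  have hm : s(j, j + 1) ∈ (List.range' 1 (a - 1)).map (fun i => s(i, i + 1)) :=
    List.mem_map.2 ⟨j, by rw [List.mem_range'_1]; omega, rfl⟩
  rw [h, List.idxOf_append_of_mem hm]
  refine (List.idxOf_lt_length_iff.2 hm).trans_le (by simp)

theorem idxOf_last (ha' : a ≠ 2) :
    ((cycle a ha).add U).edges.idxOf s(a, 1) = a - 1 := by
  have h : ((cycle a ha).add U).edges = (List.range' 1 (a - 1)).map (fun i => s(i, i + 1)) ++
      ([s(a, 1)] ++ U.edges.map (shiftEdge (a - 1))) := by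
    rw [← List.append_assoc]
    have : [s(a, 1)] = if a = 2 then [] else [s(a, 1)] := by rw [if_neg ha']
    rw [this]
    rfl
  have hm : s(a, 1) ∉ (List.range' 1 (a - 1)).map (fun i => s(i, i + 1)) := by
    rw [List.mem_map]
    rintro ⟨i, hi, h⟩
    rw [List.mem_range'_1] at hi
    rw [Sym2.eq_iff] at h
    omega
  rw [h, List.idxOf_append_of_notMem hm]
  simp

/-- A cycle contains every edge of `C_a`, so a broken circuit avoiding the cut edge at `d ∈ D` would
have to arise by removing exactly this edge; but it precedes `(a, 1)` and is not the largest. -/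
theorem isNonBroken_cutEdges (ha : 2 ≤ a) (hU : U.IsTree) (b : Bool) {D : Finset ℕ}
    (hD : D ⊆ Ioo 0 a) (hne : D.Nonempty) :
    ((cycle a ha).add U).IsNonBroken (cutEdges a U b D) := by
  constructor
  · intro e he
    rw [List.mem_toFinset, mem_edges_cycle_add]
    rcases mem_cutEdges.1 he with ⟨j, h1, h2, _, h⟩ | ⟨_, h⟩ | h
    · exact Or.inl ⟨j, h1, h2, h⟩
    · exact Or.inr (Or.inl h)
    · exact Or.inr (Or.inr h)
  · rintro B ⟨v, c, hc, e, he, hmax, rfl⟩ hB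
    obtain ⟨h1, h2, ha'⟩ := mem_edges_of_isCycle hU hc
    obtain ⟨d, hd⟩ := hne
    have hd' := mem_Ioo.1 (hD hd)
    have hde : e = s(d, d + 1) := by
      by_contra hcon
      have : s(d, d + 1) ∈ cutEdges a U b D :=
        hB (mem_erase.2 ⟨Ne.symm hcon, List.mem_toFinset.2 (h1 d hd'.1 hd'.2)⟩)
      exact (path_mem_cutEdges ha' hd'.1 hd'.2).1 this hd
    have h3 := hmax _ h2
    rw [hde, idxOf_last ha'] at h3
    have := idxOf_path_lt (ha := ha) (U := U) hd'.1 hd'.2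
    omega

-- The path is grown downwards from `a`, so each new vertex lies below the whole support and the
-- walk remains a path.
open SimpleGraph in
theorem exists_path (ha : 2 ≤ a) (U : LabeledGraph) (m : ℕ) (hm : m < a) :
    ∃ p : ((cycle a ha).add U).toSimpleGraph.Walk (a - m) a, p.IsPath ∧
      (∀ x ∈ p.support, a - m ≤ x) ∧
      ∀ e, e ∈ p.edges ↔ ∃ j, a - m ≤ j ∧ j < a ∧ e = s(j, j + 1) := by
  induction m with
  | zero =>
    refine ⟨Walk.nil, Walk.IsPath.nil, by simp, fun e => ?_⟩
    simp only [Nat.sub_zero, Walk.edges_nil, List.not_mem_nil, false_iff]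
    rintro ⟨j, h1, h2, _⟩
    omega
  | succ m ih =>
    obtain ⟨p, h1, h2, h3⟩ := ih (by omega)
    have hadj : ((cycle a ha).add U).toSimpleGraph.Adj (a - (m + 1)) (a - m) := by
      rw [toSimpleGraph, fromEdgeSet_adj]
      refine ⟨mem_edges_cycle_add.2 (Or.inl ⟨a - (m + 1), by omega, by omega, ?_⟩), by omega⟩
      congr 2
      omega
    refine ⟨Walk.cons hadj p, ?_, ?_, ?_⟩
    · rw [Walk.cons_isPath_iff]
      exact ⟨h1, fun h => by have := h2 _ h; omega⟩
    · intro x hx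
      rw [Walk.support_cons, List.mem_cons] at hx
      rcases hx with rfl | hx
      · exact le_rfl
      · have := h2 x hx
        omega
    · intro e
      rw [Walk.edges_cons, List.mem_cons, h3]
      constructor
      · rintro (rfl | ⟨j, hj, hja, rfl⟩)
        · refine ⟨a - (m + 1), le_rfl, by omega, ?_⟩
          congr 2
          omega
        · exact ⟨j, by omega, hja, rfl⟩
      · rintro ⟨j, hj, hja, rfl⟩
        by_cases hjm : j = a - (m + 1)
        · left
          rw [hjm]
          congr 2
          omega
        · exact Or.inr ⟨j, by omega, hja, rfl⟩

-- The path edges together form the broken circuit `C_a` minus `(a, 1)`.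
open SimpleGraph in
theorem exists_path_notMem (ha : 2 ≤ a) (ha' : a ≠ 2) {F : Finset (Sym2 ℕ)}
    (hF : ((cycle a ha).add U).IsNonBroken F) : ∃ j ∈ Ioo 0 a, s(j, j + 1) ∉ F := by
  by_contra! hcon
  have h1 := exists_path ha U (a - 1) (by omega)
  rw [Nat.sub_sub_self (by omega)] at h1
  obtain ⟨p, hp, -, hpe⟩ := h1
  have hlast : s(a, 1) ∉ p.edges := by
    rw [hpe]
    rintro ⟨j, h1, h2, h⟩
    rw [Sym2.eq_iff] at h
    omega
  have hadj : ((cycle a ha).add U).toSimpleGraph.Adj a 1 := by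
    rw [toSimpleGraph, fromEdgeSet_adj]
    exact ⟨mem_edges_cycle_add.2 (Or.inr (Or.inl rfl)), by omega⟩
  refine hF.2 _ ⟨a, Walk.cons hadj p, (Walk.cons_isCycle_iff _ _).2 ⟨hp, hlast⟩, s(a, 1),
    by simp, ?_, rfl⟩ ?_
  · intro f hf
    rw [Walk.edges_cons, List.mem_cons, hpe] at hf
    rcases hf with rfl | ⟨j, h1, h2, rfl⟩
    · exact le_rfl
    · rw [idxOf_last ha']
      exact (idxOf_path_lt (by omega) h2).le
  · intro e he
    rw [mem_erase, List.mem_toFinset, Walk.edges_cons, List.mem_cons, hpe] at he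
    obtain ⟨h1, h2 | ⟨j, h2, h3, rfl⟩⟩ := he
    · exact absurd h2 h1
    · exact hcon j (by rw [mem_Ioo]; omega)

theorem exists_eq_cutEdges (ha : 2 ≤ a) {F : Finset (Sym2 ℕ)}
    (hF : ((cycle a ha).add U).IsNonBroken F)
    (hFU : ∀ e ∈ U.edges.map (shiftEdge (a - 1)), e ∈ F) :
    ∃ b, ∃ D ⊆ Ioo 0 a, D.Nonempty ∧ F = cutEdges a U b D := by
  have hsub : ∀ e ∈ F, (∃ j, 0 < j ∧ j < a ∧ e = s(j, j + 1)) ∨ e = s(a, 1) ∨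
      e ∈ U.edges.map (shiftEdge (a - 1)) := fun e he =>
    mem_edges_cycle_add.1 (List.mem_toFinset.1 (hF.1 he))
  by_cases ha' : a = 2
  · subst ha'
    -- For `a = 2` there is no freedom in `D`; whether the only edge of `C_2` is present is recorded
    -- by `b`.
    refine ⟨decide (s(2, 1) ∈ F), {1}, by simp, by simp, ?_⟩
    ext e
    rw [mem_cutEdges, decide_eq_true_iff]
    constructor
    · intro he
      rcases hsub e he with ⟨j, h1, h2, rfl⟩ | rfl | h
      · have : j = 1 := by omega
        subst this
        have h3 : s(1, 1 + 1) = s(2, 1) := Sym2.eq_swap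
        rw [h3] at he ⊢
        exact Or.inr (Or.inl ⟨he, rfl⟩)
      · exact Or.inr (Or.inl ⟨he, rfl⟩)
      · exact Or.inr (Or.inr h)
    · rintro (⟨j, h1, h2, h3, rfl⟩ | ⟨h, rfl⟩ | h)
      · rw [mem_singleton] at h3
        omega
      · exact h
      · exact hFU e h
  · obtain ⟨j, hj, hjF⟩ := exists_path_notMem ha ha' hF
    refine ⟨decide (s(a, 1) ∈ F), {j ∈ Ioo 0 a | s(j, j + 1) ∉ F}, filter_subset _ _,
      ⟨j, by simp only [mem_filter]; exact ⟨hj, hjF⟩⟩, ?_⟩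
    ext e
    rw [mem_cutEdges, decide_eq_true_iff]
    constructor
    · intro he
      rcases hsub e he with ⟨j, h1, h2, rfl⟩ | rfl | h
      · exact Or.inl ⟨j, h1, h2, by simp [he], rfl⟩
      · exact Or.inr (Or.inl ⟨he, rfl⟩)
      · exact Or.inr (Or.inr h)
    · rintro (⟨j, h1, h2, h3, rfl⟩ | ⟨h, rfl⟩ | h)
      · rw [mem_filter, mem_Ioo] at h3
        by_contra h4
        exact h3 ⟨⟨h1, h2⟩, h4⟩
      · exact h
      · exact hFU e h

/-- The cut label, counted cyclically if `b` is true. -/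
def componentLabel (b : Bool) (D : Finset ℕ) (v : ℕ) : ℕ :=
  if b then cyclicCutLabel D v else cutLabel D v

/-- An uncut path edge does not change the number of cuts passed, and all of `U` lies beyond every
cut. The edge `(a, 1)` joins the labels `#D` and 0, which the cyclic label identifies. -/
theorem componentLabel_eq_of_mem_cutEdges (ha : 0 < a) {b : Bool} {D : Finset ℕ}
    (hD : D ⊆ Ioo 0 a) {x y : ℕ} (h : s(x, y) ∈ cutEdges a U b D) :
    componentLabel b D x = componentLabel b D y := by
  have hDa : ∀ d ∈ D, 0 < d ∧ d < a := fun d hd => mem_Ioo.1 (hD hd)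
  have hcard : ∀ v, a ≤ v → cutLabel D v = #D := fun v hv =>
    cutLabel_eq_card fun d hd => by have := hDa d hd; omega
  have key : ∀ x y, cutLabel D x = cutLabel D y →
      componentLabel b D x = componentLabel b D y := by
    intro x y h
    rw [componentLabel, componentLabel, cyclicCutLabel, cyclicCutLabel, h]
  rcases mem_cutEdges.1 h with ⟨j, h1, h2, h3, h⟩ | ⟨hb, h⟩ | h
  · have hj : cutLabel D j = cutLabel D (j + 1) := by
      rw [cutLabel, cutLabel]
      congr 1
      refine filter_congr fun d hd => ?_
      have : d ≠ j := fun h => h3 (h ▸ hd)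
      omega
    rcases Sym2.eq_iff.1 h with ⟨rfl, rfl⟩ | ⟨rfl, rfl⟩
    · exact key _ _ hj
    · exact key _ _ hj.symm
  · have h0 : componentLabel b D a = 0 := by
      rw [componentLabel, if_pos hb, cyclicCutLabel, if_pos (hcard a le_rfl)]
    have h1 : componentLabel b D 1 = 0 := by
      have : cutLabel D 1 = 0 := cutLabel_eq_zero fun d hd => (hDa d hd).1
      rw [componentLabel, if_pos hb, cyclicCutLabel, this]
      split <;> rfl
    rcases Sym2.eq_iff.1 h with ⟨rfl, rfl⟩ | ⟨rfl, rfl⟩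
    · rw [h0, h1]
    · rw [h0, h1]
  · have := le_of_mem_shift_edges ha h
    exact key _ _ (by rw [hcard x this.1, hcard y this.2.1])

-- Equal labels mean that no cut lies between `u` and `v`, so the path edges between them are all
-- present.
open SimpleGraph in
theorem reachable_of_cutLabel_eq {b : Bool} {D : Finset ℕ} {u v : ℕ}
    (h0 : 0 < u) (huv : u ≤ v) (hv : v ≤ a) (h : cutLabel D u = cutLabel D v) :
    (fromEdgeSet (cutEdges a U b D : Set (Sym2 ℕ))).Reachable u v := by
  induction v, huv using Nat.le_induction with
  | base => exact Reachable.refl _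
  | succ v huv ih =>
    have mono : ∀ x y, x ≤ y → cutLabel D x ≤ cutLabel D y := fun x y hxy =>
      card_le_card (monotone_filter_right _ fun d _ hd => hd.trans_le hxy)
    have h1 := mono _ _ huv
    have h2 := mono _ _ (Nat.le_succ v)
    have hvD : v ∉ D := by
      intro hvD
      have h4 : cutLabel D v < cutLabel D (v + 1) := by
        refine card_lt_card ⟨monotone_filter_right _ fun d _ hd => hd.trans (by omega), fun h => ?_⟩
        have := h (mem_filter.2 ⟨hvD, by omega⟩)
        simp at this
      omega
    refine (ih (by omega) (by rw [Nat.succ_eq_add_one] at h2; omega)).trans (Adj.reachable ?_)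
    rw [fromEdgeSet_adj]
    exact ⟨mem_coe.2 (mem_cutEdges.2 (Or.inl ⟨v, by omega, by omega, hvD, rfl⟩)), by omega⟩

open SimpleGraph in
theorem reachable_cutEdges_iff (hU : U.IsTree) (ha : 2 ≤ a) {b : Bool} {D : Finset ℕ}
    (hD : D ⊆ Ioo 0 a) {u v : ℕ} (hu : u ∈ Icc 1 (a + U.size - 1))
    (hv : v ∈ Icc 1 (a + U.size - 1)) :
    (fromEdgeSet (cutEdges a U b D : Set (Sym2 ℕ))).Reachable u v ↔
      componentLabel b D u = componentLabel b D v := by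
  refine ⟨eq_of_reachable_fromEdgeSet _ fun x y h =>
    componentLabel_eq_of_mem_cutEdges (by omega) hD (mem_coe.1 h), fun h => ?_⟩
  have hDa : ∀ d ∈ D, 0 < d ∧ d < a := fun d hd => mem_Ioo.1 (hD hd)
  have hcard : ∀ v, a ≤ v → cutLabel D v = #D := fun v hv =>
    cutLabel_eq_card fun d hd => by have := hDa d hd; omega
  have hone : cutLabel D 1 = 0 := cutLabel_eq_zero fun d hd => (hDa d hd).1
  -- Vertices of `U` are first moved to `a`, which has the same label; this reduces connectivity to
  -- the path `1, …, a`.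
  have hend : ∀ w ∈ Icc 1 (a + U.size - 1), ∃ w', 0 < w' ∧ w' ≤ a ∧
      (fromEdgeSet (cutEdges a U b D : Set (Sym2 ℕ))).Reachable w' w ∧
      cutLabel D w' = cutLabel D w := by
    intro w hw
    rw [mem_Icc] at hw
    obtain h | h := le_total w a
    · exact ⟨w, by omega, h, Reachable.refl _, rfl⟩
    · exact ⟨a, by omega, le_rfl, reachable_of_shift_edges_subset hU (by omega)
        (fun e he => mem_coe.2 (mem_cutEdges.2 (Or.inr (Or.inr he)))) h hw.2,
        by rw [hcard w h, hcard a le_rfl]⟩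
  have hsame : ∀ x ∈ Icc 1 (a + U.size - 1), ∀ y ∈ Icc 1 (a + U.size - 1),
      cutLabel D x = cutLabel D y →
      (fromEdgeSet (cutEdges a U b D : Set (Sym2 ℕ))).Reachable x y := by
    intro x hx y hy hxy
    obtain ⟨x', hx0, hxa, hx1, hx2⟩ := hend x hx
    obtain ⟨y', hy0, hya, hy1, hy2⟩ := hend y hy
    refine (hx1.symm.trans ?_).trans hy1
    obtain h | h := le_total x' y'
    · exact reachable_of_cutLabel_eq hx0 h hya (by omega)
    · exact (reachable_of_cutLabel_eq hy0 h hxa (by omega)).symm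
  cases b with
  | false => exact hsame u hu v hv (by simpa [componentLabel] using h)
  | true =>
    have ha1 : a ∈ Icc 1 (a + U.size - 1) := by
      have := U.size_pos
      rw [mem_Icc]
      omega
    have h11 : 1 ∈ Icc 1 (a + U.size - 1) := by
      rw [mem_Icc] at ha1 ⊢
      omega
    have hlast : (fromEdgeSet (cutEdges a U true D : Set (Sym2 ℕ))).Reachable a 1 := by
      refine Adj.reachable ?_
      rw [fromEdgeSet_adj]
      exact ⟨mem_coe.2 (mem_cutEdges.2 (Or.inr (Or.inl ⟨rfl, rfl⟩))), by omega⟩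
    have hrep : ∀ x ∈ Icc 1 (a + U.size - 1), componentLabel true D x = 0 →
        (fromEdgeSet (cutEdges a U true D : Set (Sym2 ℕ))).Reachable x 1 := by
      intro x hx h0
      simp only [componentLabel, cyclicCutLabel, if_true] at h0
      split at h0
      · rename_i h1
        exact (hsame x hx a ha1 (by rw [h1, hcard a le_rfl])).trans hlast
      · exact hsame x hx 1 h11 (by rw [h0, hone])
    by_cases h0 : componentLabel true D u = 0
    · exact (hrep u hu h0).trans (hrep v hv (h ▸ h0)).symm
    · have h0' : componentLabel true D v ≠ 0 := h ▸ h0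
      simp only [componentLabel, cyclicCutLabel, if_true] at h h0 h0'
      refine hsame u hu v hv ?_
      split at h0
      · omega
      · split at h0'
        · omega
        · rename_i h1 h2
          rwa [if_neg h1, if_neg h2] at h

/-- The edges of `F` with both ends in `V`. -/
def inducedEdges (F : Finset (Sym2 ℕ)) (V : Finset ℕ) : Finset (Sym2 ℕ) := {e ∈ F | e ∈ V.sym2}

theorem mem_inducedEdges {F : Finset (Sym2 ℕ)} {V : Finset ℕ} {e : Sym2 ℕ} :
    e ∈ inducedEdges F V ↔ e ∈ F ∧ ∀ w ∈ e, w ∈ V := by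
  rw [inducedEdges, mem_filter, mem_sym2_iff]

theorem isComponent_cutEdges_iff (hU : U.IsTree) (ha : 2 ≤ a) {b : Bool} {D : Finset ℕ}
    (hD : D ⊆ Ioo 0 a) {V : Finset ℕ} {E : Finset (Sym2 ℕ)} :
    ((cycle a ha).add U).IsComponent (cutEdges a U b D) V E ↔
      V ∈ fibers (componentLabel b D) (Ioc 0 (a + U.size - 1)) ∧
        E = inducedEdges (cutEdges a U b D) V := by
  rw [IsComponent, size_cycle_add]
  refine and_congr ?_ ?_
  · rw [fibers, mem_image]
    have hI : Ioc 0 (a + U.size - 1) = Icc 1 (a + U.size - 1) := rfl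
    rw [hI]
    refine exists_congr fun v => and_congr_right fun hv => ?_
    rw [eq_comm, Finset.ext_iff]
    refine forall_congr' fun w => iff_congr Iff.rfl ?_
    rw [mem_filter]
    exact and_congr_right fun hw => (reachable_cutEdges_iff hU ha hD hv hw).trans eq_comm
  · rw [Finset.ext_iff]
    simp only [mem_inducedEdges]

end LabeledGraph

/-! ### Sums over forest triples as products over trees -/

/-- With the trees fixed, a forest triple is an independent choice of `(α, r)` for each tree, so
this is the distributive law. -/
theorem sum_prod_treeTriple {R : Type*} [CommRing R] (𝒱 : Finset (Finset ℕ))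
    (E : Finset ℕ → Finset (Sym2 ℕ)) (S : Finset (Finset TreeTriple))
    (hS : ∀ 𝓕, 𝓕 ∈ S ↔ (∀ t ∈ 𝓕, (t.verts ∈ 𝒱 ∧ t.edges = E t.verts) ∧ t.IsValid) ∧
      ∀ V ∈ 𝒱, ∃! t, t ∈ 𝓕 ∧ t.verts = V ∧ t.edges = E V)
    (g : TreeTriple → R) :
    ∑ 𝓕 ∈ S, ∏ t ∈ 𝓕, g t =
      ∏ V ∈ 𝒱, ∑ α ∈ compLists #V, ∑ r ∈ Icc 1 (α.getD 0 0), g ⟨V, E V, α, r⟩ := by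
  classical
  have h1 : ∀ V ∈ 𝒱, ∑ α ∈ compLists #V, ∑ r ∈ Icc 1 (α.getD 0 0), g ⟨V, E V, α, r⟩ =
      ∑ x ∈ (compLists #V).sigma fun α => Icc 1 (α.getD 0 0), g ⟨V, E V, x.1, x.2⟩ :=
    fun V _ => by rw [sum_sigma]
  rw [prod_congr rfl h1, prod_sum]
  symm
  refine sum_bij (fun p _ => 𝒱.attach.map ⟨fun V => ⟨V.1, E V.1, (p V.1 V.2).1, (p V.1 V.2).2⟩,
    fun V W h => Subtype.ext (congrArg TreeTriple.verts h)⟩) ?_ ?_ ?_ ?_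
  · intro p hp
    rw [mem_pi] at hp
    rw [hS]
    constructor
    · intro t ht
      obtain ⟨⟨V, hV⟩, -, rfl⟩ := mem_map.1 ht
      have := hp V hV
      rw [mem_sigma, mem_compLists, mem_Icc] at this
      exact ⟨⟨hV, rfl⟩, this.1.1, this.1.2, this.2.1, this.2.2⟩
    · intro V hV
      refine ⟨⟨V, E V, (p V hV).1, (p V hV).2⟩, ⟨?_, rfl, rfl⟩, ?_⟩
      · exact mem_map.2 ⟨⟨V, hV⟩, mem_attach _ _, rfl⟩
      · rintro t ⟨ht, rfl, -⟩
        obtain ⟨⟨V, hV⟩, -, rfl⟩ := mem_map.1 ht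
        rfl
  · intro p hp q hq h
    funext V hV
    have h2 : (⟨V, E V, (p V hV).1, (p V hV).2⟩ : TreeTriple) ∈
        𝒱.attach.map ⟨fun V => (⟨V.1, E V.1, (q V.1 V.2).1, (q V.1 V.2).2⟩ : TreeTriple),
          fun V W h => Subtype.ext (congrArg TreeTriple.verts h)⟩ := by
      rw [← h]
      exact mem_map.2 ⟨⟨V, hV⟩, mem_attach _ _, rfl⟩
    obtain ⟨⟨W, hW⟩, -, h3⟩ := mem_map.1 h2
    obtain ⟨rfl, -, h3, h4⟩ := TreeTriple.mk.inj h3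
    exact Sigma.ext h3.symm (heq_of_eq h4.symm)
  · intro 𝓕 h𝓕
    obtain ⟨h2, h3⟩ := (hS 𝓕).1 h𝓕
    choose f hf hf' using h3
    refine ⟨fun V hV => ⟨(f V hV).comp, (f V hV).r⟩, ?_, ?_⟩
    · rw [mem_pi]
      intro V hV
      obtain ⟨h4, h5, h6⟩ := hf V hV
      obtain ⟨-, h7, h8, h9, h10⟩ := h2 _ h4
      rw [mem_sigma, mem_compLists, mem_Icc]
      rw [h5] at h8
      exact ⟨⟨h7, h8⟩, h9, h10⟩
    · ext t
      rw [mem_map]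
      have key : ∀ V (hV : V ∈ 𝒱), (⟨V, E V, (f V hV).comp, (f V hV).r⟩ : TreeTriple) = f V hV := by
        intro V hV
        obtain ⟨h4, h5, h6⟩ := hf V hV
        exact TreeTriple.ext h5.symm h6.symm rfl rfl
      constructor
      · rintro ⟨⟨V, hV⟩, -, rfl⟩
        have h4 := (hf V hV).1
        rw [← key V hV] at h4
        exact h4
      · intro ht
        obtain ⟨⟨h4, h5⟩, -⟩ := h2 t ht
        exact ⟨⟨t.verts, h4⟩, mem_attach _ _, (key _ h4).trans (hf' _ h4 t ⟨ht, rfl, h5⟩).symm⟩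
  · intro p hp
    rw [prod_map]
    rfl

namespace LabeledGraph

theorem IsComponent.mem_iff {G : LabeledGraph} {F : Finset (Sym2 ℕ)} {V : Finset ℕ}
    {E : Finset (Sym2 ℕ)} (h : G.IsComponent F V E) {v : ℕ} (hv : v ∈ V) (w : ℕ) :
    w ∈ V ↔ w ∈ Icc 1 G.size ∧ (SimpleGraph.fromEdgeSet (F : Set (Sym2 ℕ))).Reachable v w := by
  obtain ⟨⟨x, -, hx⟩, -⟩ := h
  have h1 := ((hx v).1 hv).2
  rw [hx]
  exact and_congr_right fun _ => ⟨fun h => h1.symm.trans h, fun h => h1.trans h⟩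

theorem exists_isComponent {G : LabeledGraph} (F : Finset (Sym2 ℕ)) {v : ℕ}
    (hv : v ∈ Icc 1 G.size) : ∃ V E, G.IsComponent F V E ∧ v ∈ V := by
  classical
  refine ⟨{w ∈ Icc 1 G.size | (SimpleGraph.fromEdgeSet (F : Set (Sym2 ℕ))).Reachable v w}, _,
    ⟨⟨v, hv, fun w => mem_filter⟩, fun e => mem_inducedEdges⟩, ?_⟩
  exact mem_filter.2 ⟨hv, SimpleGraph.Reachable.refl _⟩

theorem existsUnique_mem_verts {G : LabeledGraph} {F : Finset (Sym2 ℕ)} {𝓕 : Finset TreeTriple}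
    (h1 : ∀ t ∈ 𝓕, G.IsComponent F t.verts t.edges)
    (h2 : ∀ V E, G.IsComponent F V E → ∃! t, t ∈ 𝓕 ∧ t.verts = V ∧ t.edges = E) {v : ℕ}
    (hv : v ∈ Icc 1 G.size) : ∃! t, t ∈ 𝓕 ∧ v ∈ t.verts := by
  obtain ⟨V, E, hVE, hvV⟩ := exists_isComponent F hv
  obtain ⟨t, ⟨ht, rfl, rfl⟩, ht'⟩ := h2 V E hVE
  refine ⟨t, ⟨ht, hvV⟩, fun t' ⟨h3, h4⟩ => ?_⟩
  have h5 : t'.verts = t.verts := by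
    ext w
    rw [(h1 t' h3).mem_iff h4, hVE.mem_iff hvV]
  refine ht' t' ⟨h3, h5, ?_⟩
  ext e
  rw [(h1 t' h3).2, hVE.2, h5]

/-- The underlying spanning forest can be read off from a forest triple, so that sums may be sorted
by it. -/
theorem biUnion_edges_eq {G : LabeledGraph} {F : Finset (Sym2 ℕ)} {𝓕 : Finset TreeTriple}
    (hF : F ⊆ G.edges.toFinset) (h1 : ∀ t ∈ 𝓕, G.IsComponent F t.verts t.edges)
    (h2 : ∀ V E, G.IsComponent F V E → ∃! t, t ∈ 𝓕 ∧ t.verts = V ∧ t.edges = E) :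
    𝓕.biUnion TreeTriple.edges = F := by
  ext e
  rw [mem_biUnion]
  constructor
  · rintro ⟨t, ht, he⟩
    exact (((h1 t ht).2 e).1 he).1
  · intro he
    induction e using Sym2.ind with
    | _ x y =>
      have he' := List.mem_toFinset.1 (hF he)
      have hx := G.edges_mem _ he' x (Sym2.mem_mk_left _ _)
      have hy := G.edges_mem _ he' y (Sym2.mem_mk_right _ _)
      have hxy := G.edges_loopless _ he'
      rw [Sym2.mk_isDiag_iff] at hxy
      obtain ⟨t, ⟨ht, hxt⟩, -⟩ := existsUnique_mem_verts h1 h2 (mem_Icc.2 hx)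
      refine ⟨t, ht, ((h1 t ht).2 _).2 ⟨he, fun w hw => ?_⟩⟩
      rcases Sym2.mem_iff.1 hw with rfl | rfl
      · exact hxt
      · refine ((h1 t ht).mem_iff hxt _).2 ⟨mem_Icc.2 hy, SimpleGraph.Adj.reachable ?_⟩
        rw [SimpleGraph.fromEdgeSet_adj]
        exact ⟨he, hxy⟩

variable {a : ℕ} {ha : 2 ≤ a} {U : LabeledGraph}

theorem mem_FTprime {𝓕 : Finset TreeTriple} :
    𝓕 ∈ FTprime a ha U ↔ ((cycle a ha).add U).IsForestTriple 𝓕 ∧ ∃ t ∈ 𝓕, a ∈ t.verts ∧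
      (∀ e ∈ U.edges, shiftEdge (a - 1) e ∈ t.edges) ∧ U.size ≤ t.last := by
  rw [FTprime, mem_filter, FT, Set.Finite.mem_toFinset]
  rfl

theorem exists_min_of_mem_FTprime {𝓕 : Finset TreeTriple} (h : 𝓕 ∈ FTprime a ha U) :
    ∃ t ∈ 𝓕, 1 ∈ t.verts ∧ t.IsValid ∧ ∀ t' ∈ 𝓕, 1 ∈ t'.verts → t' = t := by
  obtain ⟨⟨F, hF, h1, h2⟩, -⟩ := mem_FTprime.1 h
  obtain ⟨t, ⟨ht, h3⟩, h4⟩ := existsUnique_mem_verts (v := 1) (fun t ht => (h1 t ht).1) h2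
    (mem_Icc.2 ⟨le_rfl, ((cycle a ha).add U).size_pos⟩)
  exact ⟨t, ht, h3, (h1 t ht).2, fun t' h5 h6 => h4 t' ⟨h5, h6⟩⟩

open Classical in
/-- The forest triples whose trees are the components of `cutEdges a U b D`. -/
noncomputable def cutForestTriples (a : ℕ) (ha : 2 ≤ a) (U : LabeledGraph) (b : Bool)
    (D : Finset ℕ) : Finset (Finset TreeTriple) :=
  {𝓕 ∈ ((cycle a ha).add U).FT | 𝓕.biUnion TreeTriple.edges = cutEdges a U b D}

theorem mem_cutForestTriples (hU : U.IsTree) {b : Bool} {D : Finset ℕ}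
    (hD : D ⊆ Ioo 0 a) (hne : D.Nonempty) {𝓕 : Finset TreeTriple} :
    𝓕 ∈ cutForestTriples a ha U b D ↔
      (∀ t ∈ 𝓕, ((cycle a ha).add U).IsComponent (cutEdges a U b D) t.verts t.edges ∧
        t.IsValid) ∧ ∀ V E, ((cycle a ha).add U).IsComponent (cutEdges a U b D) V E →
          ∃! t, t ∈ 𝓕 ∧ t.verts = V ∧ t.edges = E := by
  rw [cutForestTriples, mem_filter, FT, Set.Finite.mem_toFinset]
  constructor
  · rintro ⟨⟨F, hF, h1, h2⟩, h3⟩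
    rw [biUnion_edges_eq hF.1 (fun t ht => (h1 t ht).1) h2] at h3
    subst h3
    exact ⟨h1, h2⟩
  · rintro ⟨h1, h2⟩
    have hF := isNonBroken_cutEdges ha hU b hD hne
    exact ⟨⟨_, hF, h1, h2⟩, biUnion_edges_eq hF.1 (fun t ht => (h1 t ht).1) h2⟩

/-- The condition `E(U) ⊆ E(T)` is automatic: `U` is connected, contained in the spanning subgraph,
and attached at `a`. Only the condition on the last part remains. -/
theorem mem_FTprime_iff_of_mem_cutForestTriples (hU : U.IsTree) {b : Bool} {D : Finset ℕ}
    (hD : D ⊆ Ioo 0 a) (hne : D.Nonempty) {𝓕 : Finset TreeTriple}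
    (h : 𝓕 ∈ cutForestTriples a ha U b D) :
    𝓕 ∈ FTprime a ha U ↔ ∀ t ∈ 𝓕, a ∈ t.verts → U.size ≤ t.last := by
  have h' := (mem_cutForestTriples hU hD hne).1 h
  have hF : ((cycle a ha).add U).IsForestTriple 𝓕 := by
    rw [cutForestTriples, mem_filter, FT, Set.Finite.mem_toFinset] at h
    exact h.1
  have hs := U.size_pos
  obtain ⟨t, ⟨ht, hat⟩, htu⟩ := existsUnique_mem_verts (v := a) (fun t ht => (h'.1 t ht).1) h'.2
    (mem_Icc.2 ⟨by omega, by rw [size_cycle_add]; omega⟩)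
  rw [mem_FTprime]
  constructor
  · rintro ⟨-, t', h1, h2, -, h3⟩ t'' h4 h5
    rwa [htu t'' ⟨h4, h5⟩, ← htu t' ⟨h1, h2⟩]
  · intro h1
    refine ⟨hF, t, ht, hat, fun e he => ?_, h1 t ht hat⟩
    have hsub : ∀ e ∈ U.edges.map (shiftEdge (a - 1)), e ∈ cutEdges a U b D :=
      fun e he => mem_cutEdges.2 (Or.inr (Or.inr he))
    have hc := (h'.1 t ht).1
    have he' : shiftEdge (a - 1) e ∈ U.edges.map (shiftEdge (a - 1)) :=
      List.mem_map.2 ⟨e, he, rfl⟩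
    refine (hc.2 _).2 ⟨hsub _ he', ?_⟩
    generalize shiftEdge (a - 1) e = e' at he'
    have hw : ∀ w, a ≤ w → w ≤ a + U.size - 1 → w ∈ t.verts := fun w h2 h3 =>
      (hc.mem_iff hat w).2 ⟨mem_Icc.2 ⟨by omega, by rwa [size_cycle_add]⟩,
        reachable_of_shift_edges_subset hU (by omega) (fun e he => mem_coe.2 (hsub e he)) h2 h3⟩
    induction e' using Sym2.ind with
    | _ x y =>
      obtain ⟨h2, h3, -, h4, h5⟩ := le_of_mem_shift_edges (by omega) he'
      intro w hwe
      rcases Sym2.mem_iff.1 hwe with rfl | rfl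
      · exact hw _ h2 h4
      · exact hw _ h3 h5

section Sums

variable {R : Type*} [CommRing R]

/-- The total weight of the tree triples with vertex set `V` allowed in `FT'(C_a + U)`, where `k`
is the size of `U`. -/
noncomputable def treeWeight (a k : ℕ) (g : Finset ℕ → List ℕ → ℕ → R) (V : Finset ℕ) : R :=
  ∑ α ∈ compLists #V, ∑ r ∈ Icc 1 (α.getD 0 0),
    if a ∈ V ∧ ¬ k ≤ α.getLastD 0 then 0 else g V α r

/-- The condition on the last part is encoded as a vanishing weight, which keeps the sum a product
over trees. -/
theorem sum_cutForestTriples (hU : U.IsTree) (g : Finset ℕ → List ℕ → ℕ → R) {b : Bool}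
    {D : Finset ℕ} (hD : D ⊆ Ioo 0 a) (hne : D.Nonempty) :
    ∑ 𝓕 ∈ cutForestTriples a ha U b D, ∏ t ∈ 𝓕,
        (if a ∈ t.verts ∧ ¬ U.size ≤ t.last then 0 else g t.verts t.comp t.r) =
      fiberProd (treeWeight a U.size g) (componentLabel b D) (Ioc 0 (a + U.size - 1)) := by
  rw [sum_prod_treeTriple (fibers (componentLabel b D) (Ioc 0 (a + U.size - 1)))
    (inducedEdges (cutEdges a U b D)) _ ?_
    (fun t => if a ∈ t.verts ∧ ¬ U.size ≤ t.last then 0 else g t.verts t.comp t.r)]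
  · rfl
  · intro 𝓕
    rw [mem_cutForestTriples hU hD hne]
    simp only [isComponent_cutEdges_iff hU ha hD]
    refine and_congr_right fun _ => ⟨fun h V hV => h V _ ⟨hV, rfl⟩, ?_⟩
    rintro h V E ⟨hV, rfl⟩
    exact h V hV

/-- Sorting by the underlying spanning forest; the two sums belong to the forests without and with
the edge `(a, 1)`. -/
theorem sum_FTprime (hU : U.IsTree) (g : Finset ℕ → List ℕ → ℕ → R) :
    ∑ 𝓕 ∈ FTprime a ha U, ∏ t ∈ 𝓕, g t.verts t.comp t.r =
      ∑ D ∈ (Ioo 0 a).powerset with D.Nonempty,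
        fiberProd (treeWeight a U.size g) (cutLabel D) (Ioc 0 (a + U.size - 1)) +
      ∑ D ∈ (Ioo 0 a).powerset with D.Nonempty,
        fiberProd (treeWeight a U.size g) (cyclicCutLabel D) (Ioc 0 (a + U.size - 1)) := by
  classical
  set 𝒟 : Finset (Finset ℕ) := {D ∈ (Ioo 0 a).powerset | D.Nonempty} with h𝒟
  have hmem : ∀ D, D ∈ 𝒟 ↔ D ⊆ Ioo 0 a ∧ D.Nonempty := by simp [h𝒟]
  have hmaps : ∀ 𝓕 ∈ FTprime a ha U, 𝓕.biUnion TreeTriple.edges ∈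
      ((univ : Finset Bool) ×ˢ 𝒟).image fun x => cutEdges a U x.1 x.2 := by
    intro 𝓕 h𝓕
    obtain ⟨⟨F, hF, h1, h2⟩, t, ht, -, h3, -⟩ := mem_FTprime.1 h𝓕
    obtain ⟨b, D, hD, hne, rfl⟩ := exists_eq_cutEdges (U := U) ha hF (fun e he => by
      obtain ⟨e', he', rfl⟩ := List.mem_map.1 he
      exact (((h1 t ht).1.2 _).1 (h3 e' he')).1)
    rw [biUnion_edges_eq hF.1 (fun t ht => (h1 t ht).1) h2]
    exact mem_image.2 ⟨(b, D), mem_product.2 ⟨mem_univ _, (hmem D).2 ⟨hD, hne⟩⟩, rfl⟩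
  have hinner : ∀ b, ∀ D ∈ 𝒟,
      ∑ 𝓕 ∈ FTprime a ha U with 𝓕.biUnion TreeTriple.edges = cutEdges a U b D,
        ∏ t ∈ 𝓕, g t.verts t.comp t.r =
      fiberProd (treeWeight a U.size g) (componentLabel b D) (Ioc 0 (a + U.size - 1)) := by
    intro b D hD'
    obtain ⟨hD, hne⟩ := (hmem D).1 hD'
    have hsub : (FTprime a ha U).filter
        (fun 𝓕 => 𝓕.biUnion TreeTriple.edges = cutEdges a U b D) ⊆
        cutForestTriples a ha U b D := by
      intro 𝓕 h𝓕
      rw [mem_filter, FTprime, mem_filter] at h𝓕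
      rw [cutForestTriples, mem_filter]
      exact ⟨h𝓕.1.1, h𝓕.2⟩
    rw [← sum_cutForestTriples (ha := ha) hU g hD hne, ← sum_subset hsub]
    · refine sum_congr rfl fun 𝓕 h𝓕 => prod_congr rfl fun t ht => ?_
      have h1 := (mem_FTprime_iff_of_mem_cutForestTriples hU hD hne (hsub h𝓕)).1
        (mem_filter.1 h𝓕).1
      rw [if_neg fun h => h.2 (h1 t ht h.1)]
    · intro 𝓕 h𝓕 h𝓕'
      have h1 : 𝓕 ∉ FTprime a ha U := fun h => h𝓕' (mem_filter.2 ⟨h, by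
        rw [cutForestTriples, mem_filter] at h𝓕
        exact h𝓕.2⟩)
      rw [mem_FTprime_iff_of_mem_cutForestTriples hU hD hne h𝓕] at h1
      push Not at h1
      obtain ⟨t, ht, h2, h3⟩ := h1
      exact prod_eq_zero ht (if_pos ⟨h2, by omega⟩)
  rw [← sum_fiberwise_of_maps_to hmaps, sum_image, sum_product, Fintype.sum_bool, add_comm]
  · congr 1
    · exact sum_congr rfl fun D hD => hinner false D hD
    · exact sum_congr rfl fun D hD => hinner true D hD
  · rintro ⟨b, D⟩ h1 ⟨b', D'⟩ h2 h
    rw [mem_coe, mem_product] at h1 h2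
    obtain ⟨h3, h4⟩ := cutEdges_injective ha ((hmem D).1 h1.2).1 ((hmem D).1 h1.2).2
      ((hmem D').1 h2.2).1 ((hmem D').1 h2.2).2 h
    rw [Prod.mk.injEq]
    exact ⟨h3, h4⟩

end Sums

end LabeledGraph

/-! ### Generating series of the signed and the unit count -/

section Weights

variable {R : Type*} [CommRing R]

theorem pow_length_mul_prod (ε : R) (w : ℕ → R) (l : List ℕ) :
    ε ^ l.length * (l.map w).prod = (l.map fun p => ε * w p).prod := by
  induction l with
  | nil => simp
  | cons p l ih =>
    simp only [List.length_cons, List.map_cons, List.prod_cons, ← ih]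
    ring

/-- The weight of a composition with distinguished first part. -/
def compWeight (ε : R) (w : ℕ → R) (h : ℕ → ℕ → R) (α : List ℕ) (r : ℕ) : R :=
  ε ^ (α.length - 1) * (h (α.getD 0 0) r * (α.tail.map w).prod)

/-- The weight of a tree triple: the first part and the root of the tree containing the vertex `1`
are weighted by `h`. -/
def tripleWeight (ε : R) (w : ℕ → R) (h : ℕ → ℕ → R) (V : Finset ℕ) (α : List ℕ) (r : ℕ) : R :=
  if 1 ∈ V then compWeight ε w h α r else compWeight ε w (fun p _ => w p) α r

/-- `compWeight` summed over the possible roots. -/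
def rootedWeight (ε : R) (w : ℕ → R) (h : ℕ → ℕ → R) (α : List ℕ) : R :=
  ∑ r ∈ Icc 1 (α.getD 0 0), compWeight ε w h α r

theorem rootedWeight_cons (ε : R) (w : ℕ → R) (h : ℕ → ℕ → R) (p : ℕ) (l : List ℕ) :
    rootedWeight ε w h (p :: l) =
      (∑ r ∈ Icc 1 p, h p r) * (l.map fun p => ε * w p).prod := by
  simp only [rootedWeight, compWeight, List.getD_cons_zero, List.length_cons,
    Nat.add_sub_cancel, List.tail_cons]
  rw [← pow_length_mul_prod, sum_mul]
  exact sum_congr rfl fun r _ => mul_left_comm _ _ _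

theorem listSeries_rootedWeight (ε : R) (w : ℕ → R) (h : ℕ → ℕ → R) :
    listSeries (rootedWeight ε w h) =
      partSeries (fun p => ∑ r ∈ Icc 1 p, h p r) * prodSeries fun p => ε * w p := by
  rw [listSeries_eq_mul _ _ _ fun p _ l => rootedWeight_cons ε w h p l]
  simp [rootedWeight, prodSeries]

theorem listSeries_onLast_rootedWeight (k : ℕ) (ε : R) (w : ℕ → R) (h : ℕ → ℕ → R) :
    listSeries (onLast k (rootedWeight ε w h)) =
      partSeries (onGe k fun p => ∑ r ∈ Icc 1 p, h p r) +
        partSeries (fun p => ∑ r ∈ Icc 1 p, h p r) *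
          (partSeries (onGe k fun p => ε * w p) * prodSeries fun p => ε * w p) := by
  rw [listSeries_onLast k _ _ _ (rootedWeight_cons ε w h), listSeries_onLast_prod]

/-- The weight of a tree depends only on its size and on whether it contains 1 and `a`; hence it is
a coefficient of one of four series. -/
theorem treeWeight_eq (a k : ℕ) (ε : R) (w : ℕ → R) (h : ℕ → ℕ → R) (V : Finset ℕ) :
    LabeledGraph.treeWeight a k (tripleWeight ε w h) V = PowerSeries.coeff #V
      (listSeries (if a ∈ V then
        onLast k (rootedWeight ε w (if 1 ∈ V then h else fun p _ => w p))
        else rootedWeight ε w (if 1 ∈ V then h else fun p _ => w p))) := by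
  rw [LabeledGraph.treeWeight, listSeries, PowerSeries.coeff_mk]
  refine sum_congr rfl fun α _ => ?_
  have h1 : ∀ r, tripleWeight ε w h V α r =
      compWeight ε w (if 1 ∈ V then h else fun p _ => w p) α r := by
    intro r
    rw [tripleWeight]
    split <;> rfl
  simp only [h1]
  by_cases haV : a ∈ V
  · simp only [haV, true_and, if_true, onLast]
    cases α with
    | nil => simp
    | cons p l =>
      simp only [ne_eq, reduceCtorEq, not_false_eq_true, true_and]
      split <;> simp_all [rootedWeight]
  · simp [haV, rootedWeight]

/-- The first summand comes from the forests in which 1 and `a` lie in different trees, the second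
from those in which `(a, 1)` joins them. -/
theorem sum_tripleWeight {a : ℕ} {ha : 2 ≤ a} {U : LabeledGraph} (hU : U.IsTree) (ε : R)
    (w : ℕ → R) (h : ℕ → ℕ → R) (m : PowerSeries R)
    (hm : m * (1 - listSeries (rootedWeight ε w fun p _ => w p)) = 1) :
    ∑ 𝓕 ∈ FTprime a ha U, ∏ t ∈ 𝓕, tripleWeight ε w h t.verts t.comp t.r =
      PowerSeries.coeff (a + U.size - 1)
        (listSeries (rootedWeight ε w h) *
            (listSeries (onLast U.size (rootedWeight ε w fun p _ => w p)) * m) +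
          degSub U.size (listSeries (onLast U.size (rootedWeight ε w h))) * m) := by
  have hs := U.size_pos
  have h0 : ∀ h : ℕ → ℕ → R, PowerSeries.coeff 0 (listSeries (rootedWeight ε w h)) = 0 := by
    intro h
    rw [listSeries_rootedWeight, PowerSeries.coeff_mul]
    simp [partSeries]
  have hC : ∀ p d, 0 < p → p < d → d < a →
      LabeledGraph.treeWeight a U.size (tripleWeight ε w h) (Ioc p d) =
        PowerSeries.coeff (d - p) (listSeries (rootedWeight ε w fun p _ => w p)) := by
    intro p d h1 h2 h3
    rw [treeWeight_eq, if_neg (by simp; omega), if_neg (by simp; omega), Nat.card_Ioc]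
  rw [LabeledGraph.sum_FTprime hU, map_add]
  congr 1
  · refine sum_nonempty_cutLabel _ _ _ _ m (by omega) (by omega) (h0 _) hm
      (fun u hu => coeff_listSeries_onLast_of_lt (by omega) _) (h0 _) hC ?_ ?_
    · intro p h1 h2
      rw [treeWeight_eq, if_pos (by simp; omega), if_neg (by simp; omega), Nat.card_Ioc]
    · intro d h1 h2
      rw [treeWeight_eq, if_neg (by simp; omega), if_pos (by simp; omega), Nat.card_Ioc,
        Nat.sub_zero]
  · refine sum_nonempty_cyclicCutLabel _ _ _ m (by omega) (by omega) (h0 _) hm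
      (fun u hu => coeff_listSeries_onLast_of_lt hu _) hC ?_
    intro s e h1 h2 h3
    have hcard : #(Ioc 0 s ∪ Ioc e (a + U.size - 1)) = a + U.size - 1 - (e - s) := by
      rw [card_union_of_disjoint, Nat.card_Ioc, Nat.card_Ioc]
      · omega
      · rw [disjoint_left]
        intro x
        simp only [mem_Ioc]
        omega
    rw [treeWeight_eq, if_pos (by simp; omega), if_pos (by simp; omega), hcard]

/-- At `ε = -1` the tree series is `DH / (1 + H)`, so `m = (1 + H) Q` with `Q = 1/(1 + H - DH)`. The
contribution of the forests separating 1 from `a` then cancels entirely against a part of the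
Leibniz expansion of the merged term. -/
theorem sum_signed_tripleWeight {a : ℕ} {ha : 2 ≤ a} {U : LabeledGraph} (hU : U.IsTree)
    (w : ℕ → R) (h : ℕ → ℕ → R) :
    ∑ 𝓕 ∈ FTprime a ha U, ∏ t ∈ 𝓕, tripleWeight (-1) w h t.verts t.comp t.r =
      PowerSeries.coeff (a + U.size - 1)
        (((1 + partSeries w) *
            degSub U.size (partSeries (onGe U.size fun p => ∑ r ∈ Icc 1 p, h p r)) -
          partSeries (onGe U.size w) *
            degSub U.size (partSeries fun p => ∑ r ∈ Icc 1 p, h p r)) *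
          prodSeries fun p => ((p : R) - 1) * w p) := by
  set H := partSeries w with hH
  set K := partSeries (onGe U.size w) with hK
  set g := prodSeries fun p => -1 * w p with hg
  set Q := prodSeries fun p => ((p : R) - 1) * w p with hQ
  have hneg : partSeries (fun p => -1 * w p) = -H := by
    rw [partSeries_mul_left]
    simp [hH]
  have hnegK : partSeries (onGe U.size fun p => -1 * w p) = -K := by
    have : (onGe U.size fun p => -1 * w p) = fun p => -1 * onGe U.size w p := by
      funext p
      simp only [onGe]
      split <;> simp
    rw [this, partSeries_mul_left]
    simp [hK]
  have hDH : partSeries (fun p => ∑ r ∈ Icc 1 p, w p) = degSub 0 H := by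
    rw [hH, degSub_partSeries]
    congr 1
    funext p
    simp
  have hDK : partSeries (onGe U.size fun p => ∑ r ∈ Icc 1 p, w p) = degSub 0 K := by
    rw [hK, degSub_partSeries]
    congr 1
    funext p
    simp [onGe]
  have h1 : g * (1 + H) = 1 := by
    have := prodSeries_mul fun p => -1 * w p
    rw [hneg] at this
    linear_combination this
  have h2 : Q * (1 + H - degSub 0 H) = 1 := by
    have h3 := prodSeries_mul fun p => ((p : R) - 1) * w p
    have h4 : partSeries (fun p => ((p : R) - 1) * w p) = degSub 0 H - H := by
      have : (fun p : ℕ => ((p : R) - 1) * w p) = fun p : ℕ => ((p : R) - (0 : ℕ)) * w p +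
          -1 * w p := by
        funext p
        push_cast
        ring
      rw [this, partSeries_add, hneg, hH, degSub_partSeries]
      ring
    rw [h4] at h3
    linear_combination h3
  have h3 : degSub 0 g * (1 + H) + g * degSub 0 H = 0 := by
    have h4 : degSub 0 (1 : PowerSeries R) = 0 := by simp [degSub_eq]
    have h5 := degSub_mul 0 g (1 + H)
    rw [h1, degSub_add, h4] at h5
    linear_combination -h5
  have hm : (1 + H) * Q * (1 - listSeries (rootedWeight (-1) w fun p _ => w p)) = 1 := by
    rw [listSeries_rootedWeight, hDH]
    linear_combination h2 - Q * degSub 0 H * h1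
  rw [sum_tripleWeight hU (-1) w h _ hm]
  simp only [listSeries_rootedWeight, listSeries_onLast_rootedWeight, hDH, hDK, hnegK, ← hg]
  congr 1
  have hneg' : degSub 0 (-K) = -degSub 0 K := by
    have h5 := degSub_add 0 K (-K)
    have h6 : degSub 0 (0 : PowerSeries R) = 0 := by simp [degSub_eq]
    rw [add_neg_cancel, h6] at h5
    linear_combination -h5
  rw [degSub_add, degSub_mul U.size, degSub_mul 0 (-K), hneg']
  generalize partSeries (fun p => ∑ r ∈ Icc 1 p, h p r) = A
  linear_combination (-A * K * Q * g * degSub 0 H - degSub U.size A * K * Q) * h1 -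
    A * K * Q * h3

/-- At `ε = 0` only compositions with a single part survive, as `0 ^ 0 = 1`; here `m = 1/(1 - DH)`.
-/
theorem sum_unit_tripleWeight {a : ℕ} {ha : 2 ≤ a} {U : LabeledGraph} (hU : U.IsTree)
    (w : ℕ → R) (h : ℕ → ℕ → R) :
    ∑ 𝓕 ∈ FTprime a ha U, ∏ t ∈ 𝓕, tripleWeight 0 w h t.verts t.comp t.r =
      PowerSeries.coeff (a + U.size - 1)
        (((partSeries fun p => ∑ r ∈ Icc 1 p, h p r) * degSub 0 (partSeries (onGe U.size w)) +
            degSub U.size (partSeries (onGe U.size fun p => ∑ r ∈ Icc 1 p, h p r))) *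
          prodSeries fun p => (p : R) * w p) := by
  have hz : partSeries (fun p => 0 * w p) = 0 := by ext; simp [partSeries]
  have hzK : partSeries (onGe U.size fun p => 0 * w p) = 0 := by ext; simp [partSeries, onGe]
  have h1 : prodSeries (fun p => 0 * w p) = 1 := by
    have := prodSeries_mul fun p => 0 * w p
    rw [hz] at this
    linear_combination this
  have hDH : partSeries (fun p => ∑ r ∈ Icc 1 p, w p) = partSeries fun p => (p : R) * w p := by
    congr 1
    funext p
    simp
  have hDK : partSeries (onGe U.size fun p => ∑ r ∈ Icc 1 p, w p) =
      degSub 0 (partSeries (onGe U.size w)) := by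
    rw [degSub_partSeries]
    congr 1
    funext p
    simp [onGe]
  rw [sum_tripleWeight hU 0 w h (prodSeries fun p => (p : R) * w p)]
  · simp only [listSeries_rootedWeight, listSeries_onLast_rootedWeight, hDH, hDK, hzK, h1]
    congr 1
    simp only [mul_zero, mul_one, add_zero]
    ring
  · rw [listSeries_rootedWeight, hDH, h1, mul_one]
    exact prodSeries_mul _

theorem coeff_partSeries_mul (u : ℕ → R) (f : PowerSeries R) (n : ℕ) :
    PowerSeries.coeff n (partSeries u * f) =
      ∑ i ∈ Icc 1 n, u i * PowerSeries.coeff (n - i) f := by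
  have h : range (n + 1) = insert 0 (Icc 1 n) := by
    ext
    simp only [mem_range, mem_insert, mem_Icc]
    omega
  rw [PowerSeries.coeff_mul, Finset.Nat.sum_antidiagonal_eq_sum_range_succ_mk, h,
    sum_insert (by simp)]
  simp only [partSeries, PowerSeries.coeff_mk, if_true, zero_mul, zero_add]
  refine sum_congr rfl fun i hi => ?_
  rw [if_neg (by have := mem_Icc.1 hi; omega)]

/-- The generating series for the signed count of `FT'(C_a + U)` with a given first part `i` and
a given root, where `k` is the size of `U`. -/
noncomputable def signedSeries (w : ℕ → R) (k i : ℕ) : PowerSeries R :=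
  PowerSeries.C ((i : R) - k) * ((if k ≤ i then 1 + partSeries w else 0) -
    partSeries (onGe k w)) * prodSeries fun p => ((p : R) - 1) * w p

/-- The generating series for the count of the unit members of `FT'(C_a + U)` with a given first
part `i` and a given root, where `k` is the size of `U`. -/
noncomputable def unitSeries (w : ℕ → R) (k i : ℕ) : PowerSeries R :=
  (degSub 0 (partSeries (onGe k w)) + PowerSeries.C (if k ≤ i then (i : R) - k else 0)) *
    prodSeries fun p => (p : R) * w p

/-- The sum is linear in `h`, and the coefficient attached to the first part `i` is the same for all
its roots. -/
theorem sum_signed_eq_sum_first {a : ℕ} {ha : 2 ≤ a} {U : LabeledGraph} (hU : U.IsTree)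
    (w : ℕ → R) (h : ℕ → ℕ → R) :
    ∑ 𝓕 ∈ FTprime a ha U, ∏ t ∈ 𝓕, tripleWeight (-1) w h t.verts t.comp t.r =
      ∑ i ∈ Icc 1 (a + U.size - 1), (∑ r ∈ Icc 1 i, h i r) *
        PowerSeries.coeff (a + U.size - 1 - i) (signedSeries w U.size i) := by
  rw [sum_signed_tripleWeight hU, degSub_partSeries, degSub_partSeries, sub_mul,
    mul_comm (1 + partSeries w), mul_comm (partSeries (onGe U.size w)), mul_assoc, mul_assoc,
    map_sub, coeff_partSeries_mul, coeff_partSeries_mul, ← sum_sub_distrib]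
  refine sum_congr rfl fun i _ => ?_
  have hC : ∀ (n : ℕ) (c : R) (A B : PowerSeries R), PowerSeries.coeff n (PowerSeries.C c * A * B) =
      c * PowerSeries.coeff n (A * B) := fun n c A B => by
    rw [mul_assoc, PowerSeries.coeff_C_mul]
  have hS : ∀ (n : ℕ) (A B C : PowerSeries R), PowerSeries.coeff n ((A - B) * C) =
      PowerSeries.coeff n (A * C) - PowerSeries.coeff n (B * C) := fun n A B C => by
    rw [sub_mul, map_sub]
  rw [signedSeries, hC, hS]
  simp only [onGe]
  split
  · ring
  · rw [zero_mul, map_zero]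
    ring

theorem sum_unit_eq_sum_first {a : ℕ} {ha : 2 ≤ a} {U : LabeledGraph} (hU : U.IsTree)
    (w : ℕ → R) (h : ℕ → ℕ → R) :
    ∑ 𝓕 ∈ FTprime a ha U, ∏ t ∈ 𝓕, tripleWeight 0 w h t.verts t.comp t.r =
      ∑ i ∈ Icc 1 (a + U.size - 1), (∑ r ∈ Icc 1 i, h i r) *
        PowerSeries.coeff (a + U.size - 1 - i) (unitSeries w U.size i) := by
  rw [sum_unit_tripleWeight hU, degSub_partSeries U.size, add_mul, mul_assoc,
    map_add, coeff_partSeries_mul, coeff_partSeries_mul, ← sum_add_distrib]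
  refine sum_congr rfl fun i _ => ?_
  rw [unitSeries, add_mul, map_add, PowerSeries.coeff_C_mul]
  simp only [onGe]
  split
  · ring
  · ring

theorem map_sum_prod {ι : Type*} (w : ℕ → R) (s : Finset ι) (m : ι → Multiset ℕ) :
    ((∑ t ∈ s, m t).map w).prod = ∏ t ∈ s, ((m t).map w).prod := by
  classical
  induction s using Finset.induction_on with
  | empty => simp
  | insert x s hx ih => rw [sum_insert hx, prod_insert hx, Multiset.map_add, Multiset.prod_add, ih]

theorem prod_tripleWeight (ε : R) (w : ℕ → R) (h : ℕ → ℕ → R) {𝓕 : Finset TreeTriple}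
    (hv : ∀ t ∈ 𝓕, t.comp ≠ []) {t₀ : TreeTriple} (ht₀ : t₀ ∈ 𝓕) (h1 : 1 ∈ t₀.verts)
    (hu : ∀ t ∈ 𝓕, 1 ∈ t.verts → t = t₀) :
    ∏ t ∈ 𝓕, tripleWeight ε w h t.verts t.comp t.r =
      ε ^ (∑ t ∈ 𝓕, (t.comp.length - 1)) * (h t₀.first t₀.r * ((ftType' 𝓕).map w).prod) := by
  have h2 : ∀ t ∈ 𝓕, tripleWeight ε w h t.verts t.comp t.r = ε ^ (t.comp.length - 1) *
      ((if 1 ∈ t.verts then h t.first t.r else 1) *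
        ((if 1 ∈ t.verts then (t.comp.tail : Multiset ℕ) else (t.comp : Multiset ℕ)).map
          w).prod) := by
    intro t ht
    rw [tripleWeight]
    split
    · simp [compWeight, TreeTriple.first]
    · cases hc : t.comp with
      | nil => exact absurd hc (hv t ht)
      | cons p l => simp [compWeight]
  rw [prod_congr rfl h2, prod_mul_distrib, prod_mul_distrib, prod_pow_eq_pow_sum, ftType',
    map_sum_prod, prod_eq_single t₀ (fun t ht hne => if_neg fun h => hne (hu t ht h))
      (fun h => absurd ht₀ h), if_pos h1]

theorem ftType_eq_cons {𝓕 : Finset TreeTriple}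
    (hv : ∀ t ∈ 𝓕, t.comp ≠ []) {t₀ : TreeTriple} (ht₀ : t₀ ∈ 𝓕) (h1 : 1 ∈ t₀.verts)
    (hu : ∀ t ∈ 𝓕, 1 ∈ t.verts → t = t₀) : ftType 𝓕 = t₀.first ::ₘ ftType' 𝓕 := by
  classical
  rw [ftType, ftType', ← add_sum_erase _ _ ht₀, ← add_sum_erase 𝓕 _ ht₀, if_pos h1,
    ← Multiset.cons_add]
  congr 1
  · cases hc : t₀.comp with
    | nil => exact absurd hc (hv t₀ ht₀)
    | cons p l => simp [TreeTriple.first, hc]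
  · refine sum_congr rfl fun t ht => ?_
    rw [if_neg fun h => (mem_erase.1 ht).1 (hu t (mem_erase.1 ht).2 h)]

end Weights

/-! ### From counts to an involution -/

/-- If in every class the signed count of `S` is non-negative and at most the number of units, then
`S` has a class-preserving sign-reversing involution all of whose fixed points are units. -/
theorem exists_signReversing_involution {S κ : Type*} [Fintype S] [DecidableEq κ] (c : S → κ)
    (sgn : S → ℤ) (hsgn : ∀ x, sgn x = 1 ∨ sgn x = -1) (unit : S → Prop)
    [DecidablePred unit] (hunit : ∀ x, unit x → sgn x = 1)
    (h : ∀ y, 0 ≤ ∑ x with c x = y, sgn x ∧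
      ∑ x with c x = y, sgn x ≤ #{x | c x = y ∧ unit x}) :
    ∃ φ : S → S, Function.Involutive φ ∧ (∀ x, c (φ x) = c x) ∧
      (∀ x, φ x ≠ x → sgn (φ x) ≠ sgn x) ∧ ∀ x, φ x = x → unit x := by
  classical
  let N : κ → Finset S := fun y => {x | c x = y ∧ sgn x = -1}
  let P : κ → Finset S := fun y => {x | c x = y ∧ sgn x = 1}
  let Q : κ → Finset S := fun y => {x | c x = y ∧ sgn x = 1 ∧ ¬ unit x}
  have hsum : ∀ y, ∑ x with c x = y, sgn x = #(P y) - #(N y) := by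
    intro y
    have h1 : ∀ x, sgn x = (if sgn x = 1 then 1 else 0) - (if sgn x = -1 then 1 else 0) := by
      intro x
      rcases hsgn x with hx | hx <;> rw [hx] <;> norm_num
    rw [sum_congr rfl fun x _ => h1 x, sum_sub_distrib, sum_boole, sum_boole, filter_filter,
      filter_filter]
  have hQP : ∀ y, #(Q y) + #{x | c x = y ∧ unit x} = #(P y) := by
    intro y
    rw [← card_union_of_disjoint]
    · congr 1
      ext x
      simp only [Q, P, mem_union, mem_filter, mem_univ, true_and]
      have := hunit x
      tauto
    · rw [disjoint_left]
      simp only [Q, mem_filter, mem_univ, true_and]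
      tauto
  -- The two bounds say exactly that `#Q ≤ #N ≤ #P`. So some `R` with `Q ⊆ R ⊆ P` has as many
  -- elements as `N`, and exchanging `R` with `N` leaves only positive units fixed.
  have hR : ∀ y, ∃ R, Q y ⊆ R ∧ R ⊆ P y ∧ #R = #(N y) := by
    intro y
    obtain ⟨h1, h2⟩ := h y
    rw [hsum] at h1 h2
    have h3 := hQP y
    refine exists_subsuperset_card_eq ?_ (by omega) (by omega)
    intro x hx
    simp only [Q, P, mem_filter, mem_univ, true_and] at hx ⊢
    exact ⟨hx.1, hx.2.1⟩
  choose R hQR hRP hcard using hR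
  let e : ∀ y, R y ≃ N y := fun y => equivOfCardEq (hcard y)
  have hN : ∀ y x, x ∈ N y ↔ c x = y ∧ sgn x = -1 := fun y x => by simp [N]
  have hRc : ∀ y x, x ∈ R y → c x = y ∧ sgn x = 1 := fun y x hx => by
    simpa [P] using hRP y hx
  have hdisj : ∀ y x, x ∈ R y → x ∉ N y := fun y x h1 h2 => by
    have h3 := (hRc y x h1).2
    rw [((hN y x).1 h2).2] at h3
    norm_num at h3
  let φ : S → S := fun x =>
    if hx : x ∈ R (c x) then e (c x) ⟨x, hx⟩ else
      if hx : x ∈ N (c x) then (e (c x)).symm ⟨x, hx⟩ else x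
  have hφR : ∀ y x (hx : x ∈ R y), φ x = e y ⟨x, hx⟩ := by
    intro y x hx
    obtain rfl := (hRc y x hx).1
    exact dif_pos hx
  have hφN : ∀ y x (hx : x ∈ N y), φ x = (e y).symm ⟨x, hx⟩ := by
    intro y x hx
    obtain rfl := ((hN y x).1 hx).1
    have : x ∉ R (c x) := fun h => hdisj _ _ h hx
    simp only [φ]
    rw [dif_neg this, dif_pos hx]
  refine ⟨φ, ?_, ?_, ?_, ?_⟩
  · intro x
    by_cases hx : x ∈ R (c x)
    · rw [hφR _ x hx, hφN (c x) _ (e (c x) ⟨x, hx⟩).2]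
      simp
    · by_cases hx' : x ∈ N (c x)
      · rw [hφN _ x hx', hφR (c x) _ ((e (c x)).symm ⟨x, hx'⟩).2]
        simp
      · have : φ x = x := by simp only [φ]; rw [dif_neg hx, dif_neg hx']
        rw [this, this]
  · intro x
    by_cases hx : x ∈ R (c x)
    · rw [hφR _ x hx]
      exact ((hN _ _).1 (e (c x) ⟨x, hx⟩).2).1
    · by_cases hx' : x ∈ N (c x)
      · rw [hφN _ x hx']
        exact (hRc _ _ ((e (c x)).symm ⟨x, hx'⟩).2).1
      · simp only [φ]
        rw [dif_neg hx, dif_neg hx']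
  · intro x hne
    by_cases hx : x ∈ R (c x)
    · rw [hφR _ x hx, ((hN _ _).1 (e (c x) ⟨x, hx⟩).2).2, (hRc _ x hx).2]
      norm_num
    · by_cases hx' : x ∈ N (c x)
      · rw [hφN _ x hx', (hRc _ _ ((e (c x)).symm ⟨x, hx'⟩).2).2, ((hN _ x).1 hx').2]
        norm_num
      · refine absurd ?_ hne
        simp only [φ]
        rw [dif_neg hx, dif_neg hx']
  · intro x heq
    by_contra hu
    rcases hsgn x with h1 | h1
    · have hx : x ∈ R (c x) := hQR _ (by simp [Q, h1, hu])
      rw [hφR _ x hx] at heq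
      have h2 := ((hN _ _).1 (e (c x) ⟨x, hx⟩).2).2
      rw [heq, h1] at h2
      norm_num at h2
    · have hx : x ∈ N (c x) := (hN _ _).2 ⟨rfl, h1⟩
      rw [hφN _ x hx] at heq
      have h2 := (hRc _ _ ((e (c x)).symm ⟨x, hx⟩).2).2
      rw [heq, h1] at h2
      norm_num at h2

/-! ### Classes with prescribed first part and root -/

section Classes

variable {R : Type*} [CommRing R] {a : ℕ} {ha : 2 ≤ a} {U : LabeledGraph}

theorem comp_ne_nil_of_mem_FTprime {𝓕 : Finset TreeTriple} (h : 𝓕 ∈ FTprime a ha U) :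
    ∀ t ∈ 𝓕, t.comp ≠ [] := by
  obtain ⟨⟨F, -, h1, -⟩, -⟩ := LabeledGraph.mem_FTprime.1 h
  intro t ht hnil
  obtain ⟨-, -, h2, h3⟩ := (h1 t ht).2
  rw [TreeTriple.first, hnil] at h3
  simp at h3
  omega

open Classical in
/-- The members of `FT'(C_a + U)` for which the tree containing the vertex `1` has first part `i`
and root `s`. -/
noncomputable def FTprimeFirst (a : ℕ) (ha : 2 ≤ a) (U : LabeledGraph) (i s : ℕ) :
    Finset (Finset TreeTriple) :=
  {𝓕 ∈ FTprime a ha U | ∃ t ∈ 𝓕, 1 ∈ t.verts ∧ t.first = i ∧ t.r = s}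

/-- Taking `h` to be the indicator of `(i, s)` selects the class. -/
theorem sum_FTprimeFirst (ε : R) (w : ℕ → R) (i s : ℕ) :
    ∑ 𝓕 ∈ FTprimeFirst a ha U i s,
        ε ^ (∑ t ∈ 𝓕, (t.comp.length - 1)) * ((ftType' 𝓕).map w).prod =
      ∑ 𝓕 ∈ FTprime a ha U, ∏ t ∈ 𝓕, tripleWeight ε w
        (fun p r => if p = i ∧ r = s then 1 else 0) t.verts t.comp t.r := by
  classical
  rw [FTprimeFirst, sum_filter]
  refine sum_congr rfl fun 𝓕 h𝓕 => ?_
  obtain ⟨t₀, h1, h2, -, h3⟩ := LabeledGraph.exists_min_of_mem_FTprime h𝓕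
  rw [prod_tripleWeight ε w _ (comp_ne_nil_of_mem_FTprime h𝓕) h1 h2 h3]
  by_cases h4 : t₀.first = i ∧ t₀.r = s
  · rw [if_pos h4, if_pos ⟨t₀, h1, h2, h4⟩, one_mul]
  · rw [if_neg h4, if_neg, zero_mul, mul_zero]
    rintro ⟨t, ht, h5, h6⟩
    rw [h3 t ht h5] at h6
    exact h4 h6

theorem sum_first_indicator {i s : ℕ} (hs : 1 ≤ s) (hsi : s ≤ i) (j : ℕ) :
    ∑ r ∈ Icc 1 j, (if j = i ∧ r = s then (1 : R) else 0) = if j = i then 1 else 0 := by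
  by_cases h : j = i
  · subst h
    simp [hs, hsi]
  · simp [h]

theorem sum_Icc_indicator (n i : ℕ) (hi : 1 ≤ i) (f : ℕ → R) :
    ∑ j ∈ Icc 1 n, (if j = i then 1 else 0) * f j = if i ≤ n then f i else 0 := by
  simp only [ite_mul, one_mul, zero_mul, sum_ite_eq', mem_Icc, hi, true_and]

theorem sum_FTprimeFirst_signed (hU : U.IsTree) (w : ℕ → R) {i s : ℕ} (hs : 1 ≤ s)
    (hsi : s ≤ i) :
    ∑ 𝓕 ∈ FTprimeFirst a ha U i s,
        (-1) ^ (∑ t ∈ 𝓕, (t.comp.length - 1)) * ((ftType' 𝓕).map w).prod =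
      if i ≤ a + U.size - 1 then
        PowerSeries.coeff (a + U.size - 1 - i) (signedSeries w U.size i) else 0 := by
  rw [sum_FTprimeFirst, sum_signed_eq_sum_first hU]
  simp only [sum_first_indicator hs hsi]
  exact sum_Icc_indicator _ i (by omega) fun i =>
    PowerSeries.coeff (a + U.size - 1 - i) (signedSeries w U.size i)

theorem sum_FTprimeFirst_unit (hU : U.IsTree) (w : ℕ → R) {i s : ℕ} (hs : 1 ≤ s)
    (hsi : s ≤ i) :
    ∑ 𝓕 ∈ FTprimeFirst a ha U i s,
        0 ^ (∑ t ∈ 𝓕, (t.comp.length - 1)) * ((ftType' 𝓕).map w).prod =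
      if i ≤ a + U.size - 1 then
        PowerSeries.coeff (a + U.size - 1 - i) (unitSeries w U.size i) else 0 := by
  rw [sum_FTprimeFirst, sum_unit_eq_sum_first hU]
  simp only [sum_first_indicator hs hsi]
  exact sum_Icc_indicator _ i (by omega) fun i =>
    PowerSeries.coeff (a + U.size - 1 - i) (unitSeries w U.size i)

end Classes

/-! ### Coefficientwise inequalities between the series -/

section Nonneg

/-- The power series over `ℤ[x₀, x₁, …]` with non-negative coefficients. -/
def nonnegSeries : Subsemiring (PowerSeries (MvPolynomial ℕ ℤ)) where
  carrier := {f | ∀ n m, 0 ≤ MvPolynomial.coeff m (PowerSeries.coeff n f)}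
  mul_mem' := by
    intro f g hf hg n m
    rw [PowerSeries.coeff_mul, MvPolynomial.coeff_sum]
    refine sum_nonneg fun x _ => ?_
    rw [MvPolynomial.coeff_mul]
    exact sum_nonneg fun y _ => mul_nonneg (hf _ _) (hg _ _)
  one_mem' := by
    intro n m
    rw [PowerSeries.coeff_one]
    split
    · rw [MvPolynomial.coeff_one]
      split <;> norm_num
    · simp
  add_mem' := by
    intro f g hf hg n m
    rw [map_add, MvPolynomial.coeff_add]
    exact add_nonneg (hf _ _) (hg _ _)
  zero_mem' := by
    intro n m
    simp

theorem C_mul_X_nonneg {c : ℤ} (hc : 0 ≤ c) (p : ℕ) (m : ℕ →₀ ℕ) :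
    0 ≤ MvPolynomial.coeff m ((c : MvPolynomial ℕ ℤ) * MvPolynomial.X p) := by
  have : (c : MvPolynomial ℕ ℤ) = MvPolynomial.C c := by simp
  rw [this, MvPolynomial.coeff_C_mul, MvPolynomial.coeff_X]
  split <;> simp [hc]

theorem partSeries_mem_nonnegSeries {u : ℕ → MvPolynomial ℕ ℤ} {c : ℕ → ℤ}
    (hc : ∀ p, 0 < p → 0 ≤ c p) (hu : ∀ p, u p = (c p : MvPolynomial ℕ ℤ) * MvPolynomial.X p) :
    partSeries u ∈ nonnegSeries := by
  intro n m
  rw [partSeries, PowerSeries.coeff_mk]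
  split
  · simp
  · rw [hu]
    exact C_mul_X_nonneg (hc _ (by omega)) _ _

theorem prodSeries_mem_nonnegSeries {u : ℕ → MvPolynomial ℕ ℤ} {c : ℕ → ℤ}
    (hc : ∀ p, 0 < p → 0 ≤ c p) (hu : ∀ p, u p = (c p : MvPolynomial ℕ ℤ) * MvPolynomial.X p) :
    prodSeries u ∈ nonnegSeries := by
  intro n
  induction n using Nat.strong_induction_on with
  | _ n ih =>
    intro m
    rw [prodSeries_eq, map_add, MvPolynomial.coeff_add]
    refine add_nonneg (nonnegSeries.one_mem n m) ?_
    rw [coeff_partSeries_mul, MvPolynomial.coeff_sum]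
    refine sum_nonneg fun i hi => ?_
    rw [mem_Icc] at hi
    rw [hu, MvPolynomial.coeff_mul]
    exact sum_nonneg fun y _ => mul_nonneg (C_mul_X_nonneg (hc _ hi.1) _ _)
      (ih _ (by omega) _)

theorem natCast_series_mem_nonnegSeries (c : ℕ) :
    PowerSeries.C (c : MvPolynomial ℕ ℤ) ∈ nonnegSeries := by
  rw [map_natCast]
  exact natCast_mem _ c

theorem onGe_X (k p : ℕ) : onGe k MvPolynomial.X p =
    (((if k ≤ p then 1 else 0 : ℤ)) : MvPolynomial ℕ ℤ) * MvPolynomial.X p := by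
  rw [onGe]
  split <;> simp

/-- The heart of the matter: with indeterminate weights, signed counts are non-negative and bounded
by unit counts. Everything reduces to non-negative expressions in `H`, `K`, `Q`, `L` by means of `L
- Q = L Q H`. -/
theorem signedSeries_nonneg (k i : ℕ) :
    signedSeries (MvPolynomial.X : ℕ → MvPolynomial ℕ ℤ) k i ∈ nonnegSeries ∧
      unitSeries (MvPolynomial.X : ℕ → MvPolynomial ℕ ℤ) k i - signedSeries MvPolynomial.X k i ∈
        nonnegSeries := by
  have hQ0 := prodSeries_mem_nonnegSeries (c := fun p => (p : ℤ) - 1)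
    (u := fun p : ℕ => ((p : MvPolynomial ℕ ℤ) - 1) * MvPolynomial.X p) (by intro p hp; omega)
    (by intro p; push_cast; ring)
  have hL0 := prodSeries_mem_nonnegSeries (c := fun p => (p : ℤ))
    (u := fun p : ℕ => (p : MvPolynomial ℕ ℤ) * MvPolynomial.X p) (by intro p hp; omega)
    (by intro p; push_cast; ring)
  have hH0 := partSeries_mem_nonnegSeries (c := fun p => 1)
    (u := (MvPolynomial.X : ℕ → MvPolynomial ℕ ℤ)) (by simp) (by simp)
  have hK0 := partSeries_mem_nonnegSeries (c := fun p => if k ≤ p then 1 else 0)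
    (u := onGe k (MvPolynomial.X : ℕ → MvPolynomial ℕ ℤ)) (by intro p hp; split <;> simp)
    (onGe_X k)
  have hQ := prodSeries_mul fun p : ℕ => ((p : MvPolynomial ℕ ℤ) - 1) * MvPolynomial.X p
  have hL := prodSeries_mul fun p : ℕ => (p : MvPolynomial ℕ ℤ) * MvPolynomial.X p
  have hDH : degSub 0 (partSeries (MvPolynomial.X : ℕ → MvPolynomial ℕ ℤ)) =
      partSeries fun p : ℕ => (p : MvPolynomial ℕ ℤ) * MvPolynomial.X p := by
    rw [degSub_partSeries]
    simp
  have hDH0 : degSub 0 (partSeries (MvPolynomial.X : ℕ → MvPolynomial ℕ ℤ)) ∈ nonnegSeries := by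
    rw [hDH]
    exact partSeries_mem_nonnegSeries (c := fun p => (p : ℤ)) (by simp) (by simp)
  have hq : (partSeries fun p : ℕ => ((p : MvPolynomial ℕ ℤ) - 1) * MvPolynomial.X p) =
      degSub 0 (partSeries (MvPolynomial.X : ℕ → MvPolynomial ℕ ℤ)) -
        partSeries MvPolynomial.X := by
    rw [hDH, eq_sub_iff_add_eq, ← partSeries_add]
    congr 1
    funext p
    ring
  -- Every part occurring in `K` is at least `k ≥ d`, so `DK` dominates `d K`.
  have hDK : ∀ d : ℕ, d ≤ k → degSub 0 (partSeries (onGe k MvPolynomial.X)) -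
      PowerSeries.C (d : MvPolynomial ℕ ℤ) * partSeries (onGe k MvPolynomial.X) ∈
        nonnegSeries := by
    intro d hd
    have : degSub 0 (partSeries (onGe k MvPolynomial.X)) -
        PowerSeries.C (d : MvPolynomial ℕ ℤ) * partSeries (onGe k MvPolynomial.X) =
        partSeries fun p : ℕ => ((p : MvPolynomial ℕ ℤ) - (d : MvPolynomial ℕ ℤ)) *
          onGe k MvPolynomial.X p := by
      rw [sub_eq_iff_eq_add, ← partSeries_mul_left, ← partSeries_add, degSub_partSeries]
      congr 1
      funext p
      push_cast
      ring
    rw [this]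
    refine partSeries_mem_nonnegSeries (c := fun p => if k ≤ p then (p : ℤ) - d else 0) ?_ ?_
    · intro p _
      split
      · omega
      · exact le_rfl
    · intro p
      rw [onGe_X]
      split
      · push_cast
        ring
      · simp
  rw [hq] at hQ
  rw [← hDH] at hL
  rw [signedSeries, unitSeries]
  have hHK : partSeries (MvPolynomial.X : ℕ → MvPolynomial ℕ ℤ) -
      partSeries (onGe k MvPolynomial.X) ∈ nonnegSeries := by
    have : partSeries (MvPolynomial.X : ℕ → MvPolynomial ℕ ℤ) -
        partSeries (onGe k MvPolynomial.X) =
        partSeries fun p : ℕ => ((if k ≤ p then 0 else 1 : ℤ) : MvPolynomial ℕ ℤ) *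
          MvPolynomial.X p := by
      rw [sub_eq_iff_eq_add, ← partSeries_add]
      congr 1
      funext p
      rw [onGe_X]
      split <;> simp
    rw [this]
    exact partSeries_mem_nonnegSeries (fun p _ => by split <;> simp) fun p => rfl
  revert hQ0 hL0 hH0 hK0 hQ hL hDH0 hDK hHK
  clear hDH hq
  generalize prodSeries (fun p : ℕ => ((p : MvPolynomial ℕ ℤ) - 1) * MvPolynomial.X p) = Q
  generalize prodSeries (fun p : ℕ => (p : MvPolynomial ℕ ℤ) * MvPolynomial.X p) = L
  generalize degSub 0 (partSeries (MvPolynomial.X : ℕ → MvPolynomial ℕ ℤ)) = DH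
  generalize degSub 0 (partSeries (onGe k (MvPolynomial.X : ℕ → MvPolynomial ℕ ℤ))) = DK
  generalize partSeries (MvPolynomial.X : ℕ → MvPolynomial ℕ ℤ) = H
  generalize partSeries (onGe k (MvPolynomial.X : ℕ → MvPolynomial ℕ ℤ)) = K
  intro hQ0 hL0 hH0 hK0 hQ hL hDH0 hDK hHK
  -- The inverses of `L` and `Q` are `1 - DH` and `1 + H - DH`, which differ by `H`.
  have hLQ : L - Q = L * Q * H := by linear_combination Q * hL - L * hQ
  by_cases hki : k ≤ i
  · rw [if_pos hki, if_pos hki]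
    have hc : (i : MvPolynomial ℕ ℤ) - k = ((i - k : ℕ) : MvPolynomial ℕ ℤ) := by
      rw [Nat.cast_sub hki]
    rw [hc]
    have hc0 := natCast_series_mem_nonnegSeries (i - k)
    generalize PowerSeries.C ((i - k : ℕ) : MvPolynomial ℕ ℤ) = c at hc0
    constructor
    · have : c * (1 + H - K) * Q = c * (1 + (H - K)) * Q := by ring
      rw [this]
      exact mul_mem (mul_mem hc0 (add_mem (one_mem _) hHK)) hQ0
    · have h0 := hDK 0 (Nat.zero_le _)
      -- Here `L - (1 + H) Q = H Q (L - 1)`, and `L - 1 = L * DH`.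
      have : (DK + c) * L - c * (1 + H - K) * Q =
          (DK - PowerSeries.C ((0 : ℕ) : MvPolynomial ℕ ℤ) * K) * L +
            c * (H * Q * L * DH + K * Q) := by
        rw [Nat.cast_zero, map_zero]
        linear_combination c * hLQ + c * H * Q * hL
      rw [this]
      exact add_mem (mul_mem h0 hL0) (mul_mem hc0 (add_mem
        (mul_mem (mul_mem (mul_mem hH0 hQ0) hL0) hDH0) (mul_mem hK0 hQ0)))
  · rw [if_neg hki, if_neg hki]
    have hc : (i : MvPolynomial ℕ ℤ) - k = -((k - i : ℕ) : MvPolynomial ℕ ℤ) := by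
      rw [Nat.cast_sub (by omega), neg_sub]
    rw [hc, map_neg, map_zero]
    have hc0 := natCast_series_mem_nonnegSeries (k - i)
    have hDK' := hDK (k - i) (by omega)
    generalize PowerSeries.C ((k - i : ℕ) : MvPolynomial ℕ ℤ) = c at hc0 hDK'
    constructor
    · have : -c * (0 - K) * Q = c * K * Q := by ring
      rw [this]
      exact mul_mem (mul_mem hc0 hK0) hQ0
    -- Replacing `Q` by `L` costs `c K (L - Q)`, which is non-negative; the rest is covered by `DK ≥
    -- c K`, where `c = k - i ≤ k`.
    · have : (DK + 0) * L - -c * (0 - K) * Q = (DK - c * K) * L + c * K * (L * Q * H) := by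
        linear_combination c * K * hLQ
      rw [this]
      exact add_mem (mul_mem hDK' hL0) (mul_mem (mul_mem hc0 hK0) (mul_mem (mul_mem hL0 hQ0) hH0))

end Nonneg

/-! ### The first-preserving involution -/

section Involution

variable {a : ℕ} {ha : 2 ≤ a} {U : LabeledGraph}

theorem sum_composition_eq_coeff {R : Type*} [CommRing R] (N : ℕ) (f : List ℕ → R) :
    ∑ c : Composition N, f c.blocks = PowerSeries.coeff N (listSeries f) := by
  rw [sum_composition, listSeries, PowerSeries.coeff_mk]

theorem prod_map_X (μ : Multiset ℕ) :
    (μ.map (MvPolynomial.X : ℕ → MvPolynomial ℕ ℤ)).prod =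
      MvPolynomial.monomial (Multiset.toFinsupp μ) 1 := by
  induction μ using Multiset.induction_on with
  | empty => simp
  | cons p μ ih =>
    rw [Multiset.map_cons, Multiset.prod_cons, ih, ← Multiset.singleton_add, map_add,
      Multiset.toFinsupp_singleton, MvPolynomial.X, MvPolynomial.monomial_mul, one_mul]

/-- Distinct multisets of parts give distinct monomials, so inequalities between polynomials become
inequalities for each single type. -/
theorem coeff_prod_map_X (μ ν : Multiset ℕ) :
    MvPolynomial.coeff (Multiset.toFinsupp ν)
      (μ.map (MvPolynomial.X : ℕ → MvPolynomial ℕ ℤ)).prod = if μ = ν then 1 else 0 := by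
  rw [prod_map_X, MvPolynomial.coeff_monomial]
  simp only [EmbeddingLike.apply_eq_iff_eq]

theorem coeff_sum_mul_prod_map_X (S : Finset (Finset TreeTriple)) (ε : ℤ)
    (μ : Multiset ℕ) :
    MvPolynomial.coeff (Multiset.toFinsupp μ) (∑ 𝓕 ∈ S,
      (ε : MvPolynomial ℕ ℤ) ^ (∑ t ∈ 𝓕, (t.comp.length - 1)) *
        ((ftType' 𝓕).map MvPolynomial.X).prod) =
      ∑ 𝓕 ∈ S, if ftType' 𝓕 = μ then ε ^ (∑ t ∈ 𝓕, (t.comp.length - 1)) else 0 := by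
  rw [MvPolynomial.coeff_sum]
  refine sum_congr rfl fun 𝓕 _ => ?_
  have : (ε : MvPolynomial ℕ ℤ) = MvPolynomial.C ε := by simp
  rw [this, ← map_pow, MvPolynomial.coeff_C_mul, coeff_prod_map_X]
  simp

theorem count_FTprimeFirst (hU : U.IsTree) {i s : ℕ} (hs : 1 ≤ s) (hsi : s ≤ i)
    (μ : Multiset ℕ) :
    0 ≤ (∑ 𝓕 ∈ FTprimeFirst a ha U i s, if ftType' 𝓕 = μ then ftSign 𝓕 else 0) ∧
      (∑ 𝓕 ∈ FTprimeFirst a ha U i s, if ftType' 𝓕 = μ then ftSign 𝓕 else 0) ≤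
        ∑ 𝓕 ∈ FTprimeFirst a ha U i s,
          if ftType' 𝓕 = μ then (0 : ℤ) ^ (∑ t ∈ 𝓕, (t.comp.length - 1)) else 0 := by
  have h1 := coeff_sum_mul_prod_map_X (FTprimeFirst a ha U i s) (-1) μ
  have h2 := coeff_sum_mul_prod_map_X (FTprimeFirst a ha U i s) 0 μ
  simp only [ftSign]
  rw [← h1, ← h2]
  push_cast
  rw [sum_FTprimeFirst_signed hU _ hs hsi, sum_FTprimeFirst_unit hU _ hs hsi]
  obtain ⟨h3, h4⟩ := signedSeries_nonneg U.size i
  split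
  · refine ⟨h3 _ _, sub_nonneg.1 ?_⟩
    have := h4 (a + U.size - 1 - i) (Multiset.toFinsupp μ)
    rwa [map_sub, MvPolynomial.coeff_sub] at this
  · simp

theorem exists_firstPreservingInvolution (hU : U.IsTree) :
    ∃ φ : FTprime a ha U → FTprime a ha U, IsFirstPreservingInvolution (FTprime a ha U) φ := by
  classical
  -- In a member of `FTprime` exactly one tree contains 1, so these sums have one term each. The
  -- class determines the full type, which is `ftType'` with the first part put back.
  let c : Finset TreeTriple → Multiset ℕ × ℕ × ℕ := fun 𝓕 =>
    (ftType' 𝓕, ∑ t ∈ 𝓕 with 1 ∈ t.verts, t.first, ∑ t ∈ 𝓕 with 1 ∈ t.verts, t.r)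
  have hc : ∀ 𝓕 : Finset TreeTriple, ∀ t₀ ∈ 𝓕, 1 ∈ t₀.verts →
      (∀ t ∈ 𝓕, 1 ∈ t.verts → t = t₀) → c 𝓕 = (ftType' 𝓕, t₀.first, t₀.r) := by
    intro 𝓕 t₀ h1 h2 h3
    have : 𝓕.filter (fun t => 1 ∈ t.verts) = {t₀} := by
      ext t
      rw [mem_filter, mem_singleton]
      exact ⟨fun h => h3 t h.1 h.2, fun h => h ▸ ⟨h1, h2⟩⟩
    simp only [c, this, sum_singleton]
  have hclass : ∀ 𝓕 ∈ FTprime a ha U, ∀ μ i s, c 𝓕 = (μ, i, s) ↔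
      𝓕 ∈ FTprimeFirst a ha U i s ∧ ftType' 𝓕 = μ := by
    intro 𝓕 h𝓕 μ i s
    obtain ⟨t₀, h1, h2, -, h3⟩ := LabeledGraph.exists_min_of_mem_FTprime h𝓕
    rw [hc 𝓕 t₀ h1 h2 h3, FTprimeFirst, mem_filter, Prod.mk.injEq, Prod.mk.injEq]
    constructor
    · rintro ⟨h4, h5, h6⟩
      exact ⟨⟨h𝓕, t₀, h1, h2, h5, h6⟩, h4⟩
    · rintro ⟨⟨-, t, h4, h5, h6⟩, h7⟩
      rw [h3 t h4 h5] at h6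
      exact ⟨h7, h6⟩
  have hsum : ∀ (f : Finset TreeTriple → ℤ) μ i s,
      ∑ x : FTprime a ha U with c x.1 = (μ, i, s), f x.1 =
        ∑ 𝓕 ∈ FTprimeFirst a ha U i s, if ftType' 𝓕 = μ then f 𝓕 else 0 := by
    intro f μ i s
    rw [sum_filter, sum_coe_sort (FTprime a ha U) fun 𝓕 => if c 𝓕 = (μ, i, s) then f 𝓕 else 0,
      FTprimeFirst, sum_filter]
    refine sum_congr rfl fun 𝓕 h𝓕 => ?_
    have := hclass 𝓕 h𝓕 μ i s
    rw [FTprimeFirst, mem_filter] at this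
    simp only [this, h𝓕, true_and, ite_and]
  have hunit : ∀ 𝓕 ∈ FTprime a ha U, (0 : ℤ) ^ (∑ t ∈ 𝓕, (t.comp.length - 1)) =
      if IsUnitFT 𝓕 then 1 else 0 := by
    intro 𝓕 h𝓕
    have h1 : (∑ t ∈ 𝓕, (t.comp.length - 1)) = 0 ↔ IsUnitFT 𝓕 := by
      rw [sum_eq_zero_iff]
      refine forall₂_congr fun t ht => ?_
      have := List.length_pos_iff.2 (comp_ne_nil_of_mem_FTprime h𝓕 t ht)
      omega
    rw [zero_pow_eq]
    simp only [h1]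
  obtain ⟨φ, h1, h2, h3, h4⟩ := exists_signReversing_involution
    (S := FTprime a ha U) (fun x => c x.1) (fun x => ftSign x.1)
    (fun x => neg_one_pow_eq_or ℤ _) (fun x => IsUnitFT x.1) (by
      intro x hx
      have : ∑ t ∈ (x : Finset TreeTriple), (t.comp.length - 1) = 0 :=
        sum_eq_zero fun t ht => by rw [hx t ht, Nat.sub_self]
      rw [ftSign, this, pow_zero]) (by
      rintro ⟨μ, i, s⟩
      rw [hsum ftSign]
      have hcard : ((#{x : FTprime a ha U | c x.1 = (μ, i, s) ∧ IsUnitFT x.1} : ℕ) : ℤ) =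
          ∑ 𝓕 ∈ FTprimeFirst a ha U i s,
            if ftType' 𝓕 = μ then (0 : ℤ) ^ (∑ t ∈ 𝓕, (t.comp.length - 1)) else 0 := by
        rw [← hsum fun 𝓕 => (0 : ℤ) ^ (∑ t ∈ 𝓕, (t.comp.length - 1)),
          sum_congr rfl fun (x : FTprime a ha U) _ => hunit x x.2, sum_boole, filter_filter]
      rw [hcard]
      by_cases hsi : 1 ≤ s ∧ s ≤ i
      · exact count_FTprimeFirst hU hsi.1 hsi.2 μ
      -- A root outside `1, …, i` is not valid, so these classes are empty.
      · have : FTprimeFirst a ha U i s = ∅ := by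
          rw [FTprimeFirst, filter_eq_empty_iff]
          rintro 𝓕 h𝓕 ⟨t, ht, h5, h6, h7⟩
          obtain ⟨t₀, -, -, h8, h9⟩ := LabeledGraph.exists_min_of_mem_FTprime h𝓕
          rw [h9 t ht h5] at h6 h7
          have := h8.2.2
          rw [h6, h7] at this
          exact hsi this
        simp [this])
  have hkey : ∀ 𝓕 : FTprime a ha U, ∀ t ∈ (𝓕 : Finset TreeTriple),
      ∀ t' ∈ (φ 𝓕 : Finset TreeTriple), 1 ∈ t.verts → 1 ∈ t'.verts →
      ftType' (φ 𝓕) = ftType' 𝓕 ∧ t'.first = t.first ∧ t'.r = t.r := by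
    intro 𝓕 t ht t' ht' h5 h6
    obtain ⟨t₀, -, -, -, h7⟩ := LabeledGraph.exists_min_of_mem_FTprime 𝓕.2
    obtain ⟨t₁, -, -, -, h8⟩ := LabeledGraph.exists_min_of_mem_FTprime (φ 𝓕).2
    have h9 := h2 𝓕
    rw [hc _ t ht h5 fun x hx hx' => (h7 x hx hx').trans (h7 t ht h5).symm,
      hc _ t' ht' h6 fun x hx hx' => (h8 x hx hx').trans (h8 t' ht' h6).symm,
      Prod.mk.injEq, Prod.mk.injEq] at h9
    exact h9
  refine ⟨φ, ⟨h1, ?_, h3, ?_⟩, h4, fun 𝓕 t ht t' ht' h5 h6 => (hkey 𝓕 t ht t' ht' h5 h6).2⟩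
  · intro 𝓕
    obtain ⟨t₀, h5, h6, -, h7⟩ := LabeledGraph.exists_min_of_mem_FTprime 𝓕.2
    obtain ⟨t₁, h8, h9, -, h10⟩ := LabeledGraph.exists_min_of_mem_FTprime (φ 𝓕).2
    obtain ⟨h11, h12, -⟩ := hkey 𝓕 t₀ h5 t₁ h8 h6 h9
    rw [ftType_eq_cons (comp_ne_nil_of_mem_FTprime 𝓕.2) h5 h6 h7,
      ftType_eq_cons (comp_ne_nil_of_mem_FTprime (φ 𝓕).2) h8 h9 h10, h11, h12]
  · intro 𝓕 h𝓕
    have : ∑ t ∈ (𝓕 : Finset TreeTriple), (t.comp.length - 1) = 0 :=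
      sum_eq_zero fun t ht => by rw [h4 𝓕 h𝓕 t ht, Nat.sub_self]
    rw [ftSign, this, pow_zero]

end Involution

/-! ### The composition formulas -/

section Formulas

variable {a : ℕ} {ha : 2 ≤ a} {U : LabeledGraph}

open Classical in
theorem elemSym_zero : elemSym 0 = 1 := by
  ext m
  rw [MvPowerSeries.coeff_one]
  change (if (∀ j, m j ≤ 1) ∧ m.degree = 0 then (1 : ℤ) else 0) = _
  congr 1
  rw [Finsupp.degree_eq_zero_iff, eq_iff_iff]
  exact ⟨fun h => h.2, fun h => by simp [h]⟩

theorem elemSymPart_coe (l : List ℕ) :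
    elemSymPart (l : Multiset ℕ) = (l.map elemSym).prod := by
  rw [elemSymPart, Multiset.map_coe, Multiset.prod_coe]

theorem elemSymPart_cons (p : ℕ) (μ : Multiset ℕ) :
    elemSymPart (p ::ₘ μ) = elemSym p * elemSymPart μ := by
  rw [elemSymPart, Multiset.map_cons, Multiset.prod_cons, elemSymPart]

/-- Weighting the first part `p` by `e_p` restores the part omitted from `ftType'`; the `i` possible
roots give the factor `i`. -/
theorem BFun_eq_sum_first (hU : U.IsTree) :
    BFun a ha U = ∑ i ∈ Icc 1 (a + U.size - 1), elemSym i * ((i : MvPowerSeries ℕ ℤ) *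
      PowerSeries.coeff (a + U.size - 1 - i) (signedSeries elemSym U.size i)) := by
  have h := sum_signed_eq_sum_first (ha := ha) hU elemSym fun p _ => elemSym p
  simp only [sum_const, Nat.card_Icc, Nat.add_sub_cancel, nsmul_eq_mul] at h
  rw [BFun, sum_congr rfl fun (i : ℕ) _ => show _ = ((i : MvPowerSeries ℕ ℤ) * elemSym i) *
    PowerSeries.coeff (a + U.size - 1 - i) (signedSeries elemSym U.size i) by ring, ← h]
  refine sum_congr rfl fun 𝓕 h𝓕 => ?_
  obtain ⟨t₀, h1, h2, -, h3⟩ := LabeledGraph.exists_min_of_mem_FTprime h𝓕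
  rw [prod_tripleWeight _ _ _ (comp_ne_nil_of_mem_FTprime h𝓕) h1 h2 h3,
    ftType_eq_cons (comp_ne_nil_of_mem_FTprime h𝓕) h1 h2 h3, elemSymPart_cons, ftSign,
    zsmul_eq_mul]
  push_cast
  rfl

theorem BFunI_eq_coeff (hU : U.IsTree) {i : ℕ} (hi : 1 ≤ i) :
    BFunI a ha U i = if i ≤ a + U.size - 1 then
      PowerSeries.coeff (a + U.size - 1 - i) (signedSeries elemSym U.size i) else 0 := by
  rw [← sum_FTprimeFirst_signed (ha := ha) hU elemSym le_rfl hi, BFunI]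
  refine sum_congr rfl fun 𝓕 _ => ?_
  rw [ftSign, zsmul_eq_mul]
  push_cast
  rfl

theorem BFun_eq_sum_BFunI (hU : U.IsTree) :
    BFun a ha U = ∑ i ∈ Icc 1 (a + U.size - 1), elemSym i * (i * BFunI a ha U i) := by
  rw [BFun_eq_sum_first hU]
  refine sum_congr rfl fun i hi => ?_
  rw [mem_Icc] at hi
  rw [BFunI_eq_coeff hU hi.1, if_pos hi.2]

theorem prod_pred_smul (l : List ℕ) :
    (((l.map fun p : ℕ => (p : ℤ) - 1).prod : ℤ) : MvPowerSeries ℕ ℤ) * (l.map elemSym).prod =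
      (l.map fun p : ℕ => ((p : MvPowerSeries ℕ ℤ) - 1) * elemSym p).prod := by
  induction l with
  | nil => simp
  | cons p l ih =>
    simp only [List.map_cons, List.prod_cons, ← ih]
    push_cast
    ring

variable {R : Type*} [CommRing R]

/-- Parts `p ≤ k` with weight `u (p - 1)` correspond to sizes `y = p - 1 < k`. The value `y = 0` is
allowed and yields the constant `u 0`; the factor `X` undoes the shift. -/
theorem partSeries_pred {k : ℕ} (hk : 1 ≤ k) (u : ℕ → R) :
    partSeries (fun p => if p ≤ k then u (p - 1) else 0) =
      PowerSeries.X * (PowerSeries.C (u 0) + partSeries u - partSeries (onGe k u)) := by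
  ext p
  cases p with
  | zero => simp [partSeries]
  | succ p =>
    rw [PowerSeries.coeff_succ_X_mul]
    simp only [partSeries, PowerSeries.coeff_mk, map_sub, map_add, PowerSeries.coeff_C, onGe,
      Nat.add_sub_cancel, Nat.succ_ne_zero, if_false]
    obtain rfl | hp := Nat.eq_zero_or_pos p
    · simp [hk]
    · rw [if_neg hp.ne', if_neg hp.ne', zero_add]
      by_cases h : k ≤ p
      · rw [if_neg (by omega), if_pos h, if_neg hp.ne', sub_self]
      · rw [if_pos (by omega), if_neg h, if_neg hp.ne', sub_zero]

theorem BFunI_eq_of_lt (hU : U.IsTree) {i : ℕ} (hi : 1 ≤ i) (hik : i ≤ U.size - 1) :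
    BFunI a ha U i =
      ∑ α : Composition (a + U.size - i - 1) with 1 ≤ α.length ∧ U.size ≤ α.part 1,
        (((U.size : ℤ) - i) * α.prodPredAfter 1) • elemSymPart (α.blocks : Multiset ℕ) := by
  rw [BFunI_eq_coeff hU hi, if_pos (by omega), sum_filter]
  refine ((sum_composition_eq_coeff _ (fun l => if 1 ≤ l.length ∧ U.size ≤ l.getD 0 0 then
    (((U.size : ℤ) - i) * ((l.drop 1).map fun p : ℕ => (p : ℤ) - 1).prod) •
      elemSymPart (l : Multiset ℕ) else 0)).trans ?_).symm
  rw [listSeries_eq_mul _ (fun p => ((U.size : MvPowerSeries ℕ ℤ) - i) * onGe U.size elemSym p)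
      (fun l => (l.map fun p : ℕ => ((p : MvPowerSeries ℕ ℤ) - 1) * elemSym p).prod),
    partSeries_mul_left, signedSeries, if_neg (show ¬ U.size ≤ i by omega), ← prodSeries, Nat.sub_right_comm]
  · congr 1
    have : PowerSeries.C ((U.size : MvPowerSeries ℕ ℤ) - i) =
        -PowerSeries.C ((i : MvPowerSeries ℕ ℤ) - U.size) := by
      rw [← map_neg, neg_sub]
    simp only [List.length_nil, nonpos_iff_eq_zero, one_ne_zero, false_and, if_false]
    rw [this, map_zero]
    ring
  · intro p _ l
    rw [← prod_pred_smul, elemSymPart_coe, onGe]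
    simp only [List.length_cons, List.getD_cons_zero, List.drop_one, List.tail_cons,
      List.map_cons, List.prod_cons, Nat.le_add_left, true_and]
    split
    · rw [zsmul_eq_mul]
      push_cast
      ring
    · simp

theorem BFunI_eq_of_ge (hU : U.IsTree) {i : ℕ} (hik : U.size ≤ i) :
    BFunI a ha U i =
      ∑ α : Composition (a + U.size - i) with 1 ≤ α.length ∧ α.part 1 ≤ U.size,
        (((i : ℤ) - U.size) * α.prodPredAfter 1) • elemSymPart α.predFirst := by
  have hs := U.size_pos
  rw [BFunI_eq_coeff hU (by omega), sum_filter]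
  refine ((sum_composition_eq_coeff _ (fun l => if 1 ≤ l.length ∧ l.getD 0 0 ≤ U.size then
    (((i : ℤ) - U.size) * ((l.drop 1).map fun p : ℕ => (p : ℤ) - 1).prod) •
      elemSymPart ((l.getD 0 0 - 1) ::ₘ (l.tail : Multiset ℕ)) else 0)).trans ?_).symm
  rw [listSeries_eq_mul _ (fun p => ((i : MvPowerSeries ℕ ℤ) - U.size) *
        if p ≤ U.size then elemSym (p - 1) else 0)
      (fun l => (l.map fun p : ℕ => ((p : MvPowerSeries ℕ ℤ) - 1) * elemSym p).prod),
    partSeries_mul_left, partSeries_pred hs, signedSeries, if_pos hik, ← prodSeries,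
    elemSym_zero]
  · have : ∀ c f g : PowerSeries (MvPowerSeries ℕ ℤ), PowerSeries.C 0 +
        c * (PowerSeries.X * f) * g = PowerSeries.X * (c * f * g) := by
      intro c f g
      rw [map_zero]
      ring
    simp only [List.length_nil, nonpos_iff_eq_zero, one_ne_zero, false_and, if_false]
    rw [this, map_one]
    split
    · have h : a + U.size - i = a + U.size - 1 - i + 1 := by omega
      rw [h, PowerSeries.coeff_succ_X_mul]
    -- For `i` beyond the number of vertices the truncated difference is 0, and the factor `X` has
    -- no constant term.
    · have h : a + U.size - i = 0 := by omega
      rw [h, PowerSeries.coeff_zero_X_mul]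
  · intro p _ l
    rw [← prod_pred_smul]
    simp only [List.length_cons, List.getD_cons_zero, List.drop_one, List.tail_cons,
      Nat.le_add_left, true_and, elemSymPart_cons, elemSymPart_coe]
    split
    · rw [zsmul_eq_mul]
      push_cast
      ring
    · simp

end Formulas

/-- With `y = α₁ - 1` and `z = α₂` the weight is `(z - y)(z + y - k) = z(z - k) - y(y - k)`: two
products, hence two products of series. In their sum the terms in which `K` multiplies `(D - k) D K`
cancel. -/
theorem BFun_eq_sum_composition {a : ℕ} {ha : 2 ≤ a} {U : LabeledGraph} (hU : U.IsTree) :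
    BFun a ha U =
      ∑ α : Composition (a + U.size) with
          2 ≤ α.length ∧ α.part 1 ≤ U.size ∧ U.size ≤ α.part 2,
        ((((α.part 2 : ℤ) - α.part 1 + 1) * ((α.part 1 : ℤ) + α.part 2 - U.size - 1)) *
          α.prodPredAfter 2) • elemSymPart α.predFirst := by
  have hs := U.size_pos
  have h0 : BFun a ha U = PowerSeries.coeff (a + U.size - 1)
      (((1 + partSeries elemSym) * degSub U.size (degSub 0 (partSeries (onGe U.size elemSym))) -
        partSeries (onGe U.size elemSym) * degSub U.size (degSub 0 (partSeries elemSym))) *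
          prodSeries fun p => ((p : MvPowerSeries ℕ ℤ) - 1) * elemSym p) := by
    have h1 := sum_signed_tripleWeight (ha := ha) hU elemSym fun p _ => elemSym p
    rw [sum_signed_eq_sum_first hU] at h1
    have h2 : (fun p => ∑ r ∈ Icc 1 p, elemSym p) =
        fun p : ℕ => ((p : MvPowerSeries ℕ ℤ) - (0 : ℕ)) * elemSym p := by
      funext p
      simp
    have h3 : onGe U.size (fun p : ℕ => ((p : MvPowerSeries ℕ ℤ) - (0 : ℕ)) * elemSym p) =
        fun p : ℕ => ((p : MvPowerSeries ℕ ℤ) - (0 : ℕ)) * onGe U.size elemSym p := by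
      funext p
      simp [onGe]
    rw [h2, h3, ← degSub_partSeries, ← degSub_partSeries] at h1
    rw [← h1, BFun_eq_sum_first hU]
    refine sum_congr rfl fun i _ => ?_
    simp only [sum_const, Nat.card_Icc, Nat.add_sub_cancel, nsmul_eq_mul]
    ring
  rw [h0, sum_filter]
  let q : List ℕ → MvPowerSeries ℕ ℤ := fun l =>
    (l.map fun p : ℕ => ((p : MvPowerSeries ℕ ℤ) - 1) * elemSym p).prod
  let v : (ℕ → MvPowerSeries ℕ ℤ) → List ℕ → MvPowerSeries ℕ ℤ := fun c l =>
    match l with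
    | [] => 0
    | z :: l => c z * onGe U.size elemSym z * q l
  have hv : ∀ c, listSeries (v c) = partSeries (fun z => c z * onGe U.size elemSym z) *
      prodSeries fun p => ((p : MvPowerSeries ℕ ℤ) - 1) * elemSym p := by
    intro c
    rw [listSeries_eq_mul (v c) (fun z => c z * onGe U.size elemSym z) q fun _ _ _ => rfl]
    simp [v, prodSeries, q]
  -- The function `z(z - k)`, by which `(D - k) D` multiplies the coefficient of degree `z`; `u₂`
  -- carries the subtracted term.
  let c₁ : ℕ → MvPowerSeries ℕ ℤ := fun z => ((z : MvPowerSeries ℕ ℤ) - U.size) * z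
  let u₂ : ℕ → MvPowerSeries ℕ ℤ := fun y => -(c₁ y * elemSym y)
  refine ((sum_composition_eq_coeff _ (fun l =>
    if 2 ≤ l.length ∧ l.getD 0 0 ≤ U.size ∧ U.size ≤ l.getD 1 0 then
      ((((l.getD 1 0 : ℤ) - l.getD 0 0 + 1) * ((l.getD 0 0 : ℤ) + l.getD 1 0 - U.size - 1)) *
        ((l.drop 2).map fun p : ℕ => (p : ℤ) - 1).prod) •
          elemSymPart ((l.getD 0 0 - 1) ::ₘ (l.tail : Multiset ℕ)) else 0)).trans ?_).symm
  rw [listSeries_eq _ (fun p => if p ≤ U.size then elemSym (p - 1) else 0)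
    (fun p => if p ≤ U.size then u₂ (p - 1) else 0) (v c₁) (v 1), hv, hv,
    partSeries_pred hs, partSeries_pred hs]
  · have h1 : partSeries (fun z => c₁ z * onGe U.size elemSym z) =
        degSub U.size (degSub 0 (partSeries (onGe U.size elemSym))) := by
      rw [degSub_partSeries, degSub_partSeries]
      congr 1
      funext z
      simp only [c₁]
      push_cast
      ring
    have h2 : partSeries (fun z => (1 : ℕ → MvPowerSeries ℕ ℤ) z * onGe U.size elemSym z) =
        partSeries (onGe U.size elemSym) := by simp
    have h3 : partSeries u₂ = -degSub U.size (degSub 0 (partSeries elemSym)) := by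
      rw [degSub_partSeries, degSub_partSeries, eq_neg_iff_add_eq_zero, ← partSeries_add]
      ext z
      simp [partSeries, u₂, c₁, mul_assoc]
    have h4 : partSeries (onGe U.size u₂) =
        -degSub U.size (degSub 0 (partSeries (onGe U.size elemSym))) := by
      rw [← h1, eq_neg_iff_add_eq_zero, ← partSeries_add]
      ext1 z
      have : onGe U.size u₂ z + c₁ z * onGe U.size elemSym z = 0 := by
        simp only [onGe, u₂]
        split <;> simp
      simp [partSeries, this]
    have h5 : u₂ 0 = 0 := by simp [u₂, c₁]
    have hn : a + U.size = a + U.size - 1 + 1 := by omega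
    rw [h1, h2, h3, h4, h5, elemSym_zero]
    simp only [List.length_nil, nonpos_iff_eq_zero, OfNat.ofNat_ne_zero, false_and, if_false,
      map_zero, map_one]
    conv_rhs => rw [← PowerSeries.coeff_succ_X_mul, ← hn]
    congr 1
    ring
  · intro p hp l
    cases l with
    | nil => simp [v]
    | cons z l =>
      simp only [v, q, onGe, List.length_cons, List.getD_cons_zero, List.getD_cons_succ,
        List.drop_succ_cons, List.drop_zero, List.tail_cons, Nat.le_add_left, true_and,
        Pi.one_apply]
      rw [← prod_pred_smul, elemSymPart_cons, elemSymPart_coe, List.map_cons, List.prod_cons]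
      by_cases h1 : p ≤ U.size
      · by_cases h2 : U.size ≤ z
        · rw [if_pos ⟨h1, h2⟩, if_pos h1, if_pos h1, if_pos h2, zsmul_eq_mul]
          have h3 : ((p - 1 : ℕ) : MvPowerSeries ℕ ℤ) = p - 1 := by
            rw [Nat.cast_sub hp, Nat.cast_one]
          simp only [u₂, c₁, h3]
          push_cast
          ring
        · simp [h2]
      · simp [h1]

/-! ### Positivity in the basis of elementary symmetric functions -/

section Positivity

theorem elemSymPart_filter (μ : Multiset ℕ) :
    elemSymPart (μ.filter fun p => p ≠ 0) = elemSymPart μ := by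
  induction μ using Multiset.induction_on with
  | empty => rfl
  | cons p μ ih =>
    by_cases hp : p = 0
    · rw [Multiset.filter_cons_of_neg (p := fun p => p ≠ 0) _ (not_not.2 hp), ih, elemSymPart_cons, hp,
        elemSym_zero, one_mul]
    · rw [Multiset.filter_cons_of_pos (p := fun p => p ≠ 0) _ hp, elemSymPart_cons, elemSymPart_cons, ih]

/-- `Nat.Partition.ofSums` drops the zero parts, which is harmless because `e_0 = 1`. -/
theorem isEPositive_elemSymPart {n : ℕ} {μ : Multiset ℕ} (h : μ.sum = n) :
    IsEPositive n (elemSymPart μ) := by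
  classical
  refine ⟨fun l => if l = Nat.Partition.ofSums n μ h then 1 else 0, ?_⟩
  simp only [ite_smul, one_smul, zero_smul, sum_ite_eq', mem_univ, if_true]
  exact (elemSymPart_filter μ).symm

theorem isEPositive_zero (n : ℕ) : IsEPositive n 0 := ⟨0, by simp⟩

theorem IsEPositive.add {n : ℕ} {f g : MvPowerSeries ℕ ℤ} (hf : IsEPositive n f)
    (hg : IsEPositive n g) : IsEPositive n (f + g) := by
  obtain ⟨c, rfl⟩ := hf
  obtain ⟨d, rfl⟩ := hg
  exact ⟨c + d, by simp only [Pi.add_apply, add_smul, sum_add_distrib]⟩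

theorem IsEPositive.zsmul {n : ℕ} {f : MvPowerSeries ℕ ℤ} (hf : IsEPositive n f) {z : ℤ}
    (hz : 0 ≤ z) : IsEPositive n (z • f) := by
  obtain ⟨c, rfl⟩ := hf
  lift z to ℕ using hz
  exact ⟨fun l => z * c l, by simp only [smul_sum, mul_smul, natCast_zsmul]⟩

theorem IsEPositive.sum {ι : Type*} {n : ℕ} {s : Finset ι} {f : ι → MvPowerSeries ℕ ℤ}
    (h : ∀ x ∈ s, IsEPositive n (f x)) : IsEPositive n (∑ x ∈ s, f x) := by
  classical
  induction s using Finset.induction_on with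
  | empty => exact isEPositive_zero n
  | insert x s hx ih =>
    rw [sum_insert hx]
    exact (h x (mem_insert_self _ _)).add (ih fun y hy => h y (mem_insert_of_mem hy))

theorem Composition.prodPredAfter_nonneg {n : ℕ} (α : Composition n) (j : ℕ) :
    0 ≤ α.prodPredAfter j := by
  refine List.prod_nonneg fun z hz => ?_
  obtain ⟨p, hp, rfl⟩ := List.mem_map.1 hz
  have := α.blocks_pos (List.mem_of_mem_drop hp)
  omega

theorem Composition.sum_predFirst {n : ℕ} (α : Composition n) (h : 1 ≤ α.length) :
    α.predFirst.sum = n - 1 := by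
  have h1 := α.blocks_sum
  have h2 : 1 ≤ α.blocks.length := h
  have h3 : ∀ p ∈ α.blocks, 0 < p := fun p hp => α.blocks_pos hp
  rw [predFirst, part, Multiset.sum_cons, Multiset.sum_coe]
  revert h1 h2 h3
  cases α.blocks with
  | nil => simp
  | cons p l =>
    intro h1 _ h3
    have := h3 p (by simp)
    simp only [List.sum_cons] at h1
    simp only [Nat.sub_self, List.getD_cons_zero, List.tail_cons]
    omega

variable {a : ℕ} {ha : 2 ≤ a} {U : LabeledGraph}

theorem isEPositive_BFun (hU : U.IsTree) : IsEPositive (a + U.size - 1) (BFun a ha U) := by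
  rw [BFun_eq_sum_composition hU]
  refine IsEPositive.sum fun α hα => ?_
  obtain ⟨-, h1, h2, h3⟩ := mem_filter.1 hα
  refine (isEPositive_elemSymPart (α.sum_predFirst (by omega))).zsmul
    (mul_nonneg (mul_nonneg (by omega) ?_) (α.prodPredAfter_nonneg 2))
  -- The second factor is `(α₁ - 1) + (α₂ - k)`, so positivity of the first part is what is needed
  -- besides `α₂ ≥ k`.
  have h4 : 1 ≤ α.part 1 := by
    have h5 : 2 ≤ α.blocks.length := h1
    have h6 : ∀ p ∈ α.blocks, 0 < p := fun p hp => α.blocks_pos hp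
    rw [Composition.part]
    revert h5 h6
    cases α.blocks with
    | nil => simp
    | cons p l => exact fun _ h => h p (by simp)
  omega

theorem isEPositive_BFunI (hU : U.IsTree) {i : ℕ} (hi : 1 ≤ i) :
    IsEPositive (a + U.size - 1 - i) (BFunI a ha U i) := by
  obtain h | h := Nat.lt_or_ge i U.size
  · rw [BFunI_eq_of_lt hU hi (by omega)]
    refine IsEPositive.sum fun α _ => ?_
    have : (α.blocks : Multiset ℕ).sum = a + U.size - 1 - i := by
      rw [Multiset.sum_coe, α.blocks_sum]
      omega
    exact (isEPositive_elemSymPart this).zsmul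
      (mul_nonneg (by omega) (α.prodPredAfter_nonneg 1))
  · rw [BFunI_eq_of_ge hU h]
    refine IsEPositive.sum fun α hα => ?_
    have : α.predFirst.sum = a + U.size - 1 - i := by
      rw [α.sum_predFirst (mem_filter.1 hα).2.1]
      omega
    exact (isEPositive_elemSymPart this).zsmul
      (mul_nonneg (by omega) (α.prodPredAfter_nonneg 1))

end Positivity

theorem mainTheorem3 (a k : ℕ) (ha : 2 ≤ a) (U : LabeledGraph) (hU : U.IsTree)
    (hk : U.size = k) :
    (∃ φ : FTprime a ha U → FTprime a ha U, IsFirstPreservingInvolution (FTprime a ha U) φ) ∧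
    BFun a ha U =
      ∑ α : Composition (a + k) with 2 ≤ α.length ∧ α.part 1 ≤ k ∧ k ≤ α.part 2,
        ((((α.part 2 : ℤ) - α.part 1 + 1) * ((α.part 1 : ℤ) + α.part 2 - k - 1)) *
          α.prodPredAfter 2) • elemSymPart α.predFirst ∧
    (∀ i : ℕ, 1 ≤ i → i ≤ k - 1 →
      BFunI a ha U i =
        ∑ α : Composition (a + k - i - 1) with 1 ≤ α.length ∧ k ≤ α.part 1,
          (((k : ℤ) - i) * α.prodPredAfter 1) • elemSymPart (α.blocks : Multiset ℕ)) ∧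
    (∀ i : ℕ, k ≤ i →
      BFunI a ha U i =
        ∑ α : Composition (a + k - i) with 1 ≤ α.length ∧ α.part 1 ≤ k,
          (((i : ℤ) - k) * α.prodPredAfter 1) • elemSymPart α.predFirst) ∧
    BFun a ha U = ∑ i ∈ Finset.Icc 1 (a + k - 1), elemSym i * (i * BFunI a ha U i) ∧
    IsEPositive (a + k - 1) (BFun a ha U) ∧
    (∀ i : ℕ, 1 ≤ i → IsEPositive (a + k - 1 - i) (BFunI a ha U i)) := by
  subst hk
  exact ⟨exists_firstPreservingInvolution hU, BFun_eq_sum_composition hU,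
    fun i hi hik => BFunI_eq_of_lt hU hi hik, fun i hik => BFunI_eq_of_ge hU hik,
    BFun_eq_sum_BFunI hU, isEPositive_BFun hU, fun i hi => isEPositive_BFunI hU hi⟩
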